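/- An AM-system is a pair of increasing homeomorphisms $f_-,f_+$ of $[0,1]$ of the form $f_-(x)=a_-x$ on $[0,x_-]$, $f_-(x)=1-b_-(1-x)$ on $(x_-,1]$, and $f_+(x)=b_+x$ on $[0,x_+]$, $f_+(x)=1-a_+(1-x)$ on $(x_+,1]$, where $0<a_\pm<1<b_\pm$, $x_-=\frac{b_--1}{b_--a_-}$, $x_+=\frac{1-a_+}{b_+-a_+}$. It is taken with probabilities $p_-,p_+>0$, $p_-+p_+=1$. It is symmetric if $1-f_-(x)=f_+(1-x)$ on $[0,1]$, and of disjoint type if $f_-(x_-)<f_+(x_+)$. Its Lyapunov exponents are $\Lambda(e)=p_-\ln f_-'(e)+p_+\ln f_+'(e)$ for $e=0,1$. For a symmetric system, $(k:1)$-resonance means $(f_-'(0))^kf_+'(0)=1$, equivalently $f_-'(1)(f_+'(1))^k=1$. For a Borel measure $\nu$ on $\mathbb R$, $\dim_H\nu=\inf\{\dim_H A: A\text{ Borel},\ \nu(\mathbb R\setminus A)=0\}$. **Theorem.** Let $\{f_-,f_+\}$ be a symmetric AM-system of disjoint type with probabilities $p_-,p_+$ such that $\Lambda(0),\Lambda(1)>0$.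 Suppose that it exhibits $(k:1)$-resonance for some $k\in\{2,3,\dots\}$, and let $\rho=f_-'(0)$. Then there is a unique Borel probability measure $\mu$ on $[0,1]$ with $\mu=p_-(f_-)_*\mu+p_+(f_+)_*\mu$ and $\mu(\{0,1\})=0$. The equations $$p_+\eta_-^{k+1}-\eta_-+p_-=0,\qquad p_-\eta_+^{k+1}-\eta_++p_+=0$$ have unique solutions $\eta_-,\eta_+\in(0,1)$, and $$\dim_H\mu=\frac{\sum_{r=1}^k r\left(\frac{p_+}{p_-}\eta_-^r\log\eta_-+\frac{p_-}{p_+}\eta_+^r\log\eta_+\right)}{\sum_{r=1}^k r\left(\frac{p_+}{p_-}\eta_-^r+\frac{p_-}{p_+}\eta_+^r\right)\log\rho}.$$ Moreover, $\mu=\pi_*\tilde\mu$, with the following notation. Put $\phi_r(x)=\rho-\rho^rx$ and $I_{-1}=[\rho f_+(x_+),f_-(x_-)]$. For $s=(r_1,r_2,\dots)\in\{1,\dots,k\}^{\mathbb N}$ let $\pi_{-1}(s)=\lim_{n\to\infty}\phi_{r_1}\circ\cdots\circ\phi_{r_n}(x)$, where the limit exists for every $x\in I_{-1}$ and does not depend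 on $x$. For $j\in\mathbb Z\setminus\{0\}$ let $\pi(j,s)=\rho^{-j-1}\pi_{-1}(s)$ if $j<0$ and $\pi(j,s)=1-\rho^{j-1}\pi_{-1}(s)$ if $j>0$. The numbers $\beta^-_r=\frac{p_-}{p_+}\eta_+^r$ and $\beta^+_r=\frac{p_+}{p_-}\eta_-^r$, $1\le r\le k$, form probability vectors $\beta^-,\beta^+$, which define probability measures $\mathbb P_{\beta^-},\mathbb P_{\beta^+}$ on $\{1,\dots,k\}$, and $$\tilde\mu=\sum_{j<0}c_-\eta_-^{-j}\,\delta_j\otimes(\mathbb P_{\beta^-}\otimes\mathbb P_{\beta^+}\otimes\mathbb P_{\beta^-}\otimes\cdots)+\sum_{j>0}c_+\eta_+^{j}\,\delta_j\otimes(\mathbb P_{\beta^+}\otimes\mathbb P_{\beta^-}\otimes\mathbb P_{\beta^+}\otimes\cdots),$$ where $c_\pm=p_\mp\left(\frac{p_+\eta_-}{1-\eta_-}+\frac{p_-\eta_+}{1-\eta_+}\right)^{-1}$. In particular, if $p_-=p_+=\frac12$, then $$\dim_H\mu=\dim_H(\operatorname{supp}\mu)=\frac{\log\eta}{\log\rho}<1,$$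 where $\operatorname{supp}\mu$ is the topological support of $\mu$ and $\eta\in(\tfrac12,1)$ is the unique solution in that interval of $\eta^{k+1}-2\eta+1=0$. -/

import Mathlib

open MeasureTheory Set Filter Topology
open scoped ENNReal

/-- The parameters of an Alsedà–Misiurewicz system `{f₋, f₊}`:
`am = a₋`, `bm = b₋`, `ap = a₊`, `bp = b₊`. -/
structure AMSystem where
  am : ℝ
  bm : ℝ
  ap : ℝ
  bp : ℝ
  am_pos : 0 < am
  am_lt_one : am < 1
  one_lt_bm : 1 < bm
  ap_pos : 0 < ap
  ap_lt_one : ap < 1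
  one_lt_bp : 1 < bp

noncomputable section

namespace AMSystem

/-- The breakpoint `x₋` of `f₋`. -/
def xMinus (S : AMSystem) : ℝ := (S.bm - 1) / (S.bm - S.am)

/-- The breakpoint `x₊` of `f₊`. -/
def xPlus (S : AMSystem) : ℝ := (1 - S.ap) / (S.bp - S.ap)

/-- The map `f₋`. It is a homeomorphism of `[0, 1]`; only its values on `[0, 1]` matter, and outside
`[0, 1]` its two affine branches are extended. -/
def fMinus (S : AMSystem) (x : ℝ) : ℝ :=
  if x ≤ S.xMinus then S.am * x else 1 - S.bm * (1 - x)

/-- The map `f₊`, with the same convention as for `f₋`. -/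
def fPlus (S : AMSystem) (x : ℝ) : ℝ :=
  if x ≤ S.xPlus then S.bp * x else 1 - S.ap * (1 - x)

/-- The (one-sided) derivative `f₋'(x)` of `f₋` as a map on `[0, 1]`. -/
def dMinus (S : AMSystem) (x : ℝ) : ℝ := derivWithin S.fMinus (Icc 0 1) x

/-- The (one-sided) derivative `f₊'(x)` of `f₊` as a map on `[0, 1]`. -/
def dPlus (S : AMSystem) (x : ℝ) : ℝ := derivWithin S.fPlus (Icc 0 1) x

/-- The Lyapunov exponent `Λ(e) = p₋ ln f₋'(e) + p₊ ln f₊'(e)` at an endpoint `e ∈ {0, 1}`. -/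
def lyapunov (S : AMSystem) (pm pp : ℝ) (e : ℝ) : ℝ :=
  pm * Real.log (S.dMinus e) + pp * Real.log (S.dPlus e)

/-- Disjoint type: `f₋(x₋) < f₊(x₊)`. -/
def IsDisjointType (S : AMSystem) : Prop := S.fMinus S.xMinus < S.fPlus S.xPlus

/-- Symmetry: `𝓘 ∘ f₋ = f₊ ∘ 𝓘` on `[0, 1]`, where `𝓘 x = 1 - x`. -/
def IsSymmetric (S : AMSystem) : Prop :=
  ∀ x ∈ Icc (0 : ℝ) 1, 1 - S.fMinus x = S.fPlus (1 - x)

/-- `(k : l)`-resonance at `0`. -/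
def HasResonanceAtZero (S : AMSystem) (k l : ℕ) : Prop := S.dMinus 0 ^ k * S.dPlus 0 ^ l = 1

/-- `(k : l)`-resonance at `1`. -/
def HasResonanceAtOne (S : AMSystem) (k l : ℕ) : Prop := S.dMinus 1 ^ l * S.dPlus 1 ^ k = 1

/-- `μ` is a stationary Borel probability measure on `[0, 1]` (regarded as a measure on `ℝ` that is
concentrated on `[0, 1]`) without atoms at the endpoints. -/
structure IsStationary (S : AMSystem) (pm pp : ℝ) (μ : Measure ℝ) : Prop where
  prob : IsProbabilityMeasure μ
  concentrated : μ (Icc 0 1)ᶜ = 0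
  stationary : μ = ENNReal.ofReal pm • μ.map S.fMinus + ENNReal.ofReal pp • μ.map S.fPlus
  endpoints : μ {0, 1} = 0

/-- The interval `I₋₁ = [ρ f₊(x₊), f₋(x₋)]`, with `ρ = f₋'(0)`. -/
def baseInterval (S : AMSystem) : Set ℝ :=
  Icc (S.dMinus 0 * S.fPlus S.xPlus) (S.fMinus S.xMinus)

end AMSystem

/-- Hausdorff dimension of a Borel measure on `ℝ`: the infimum of the Hausdorff dimensions of the
Borel sets of full measure. -/
def measureDimH (μ : Measure ℝ) : ℝ≥0∞ :=
  ⨅ (A : Set ℝ) (_ : MeasurableSet A) (_ : μ Aᶜ = 0), dimH A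

/-- One-sided sequences over the alphabet `{1, …, k}`. The element `i : Fin k` stands for the symbol
`i + 1`, and `s n` is the symbol with index `n + 1` of the sequence. -/
abbrev SymSeq (k : ℕ) : Type := ℕ → Fin k

/-- The contracting similarity `φ_r(x) = ρ - ρ ^ r x`. -/
def simMap (ρ : ℝ) (r : ℕ) (x : ℝ) : ℝ := ρ - ρ ^ r * x

/-- The composition `φ_{r₁} ∘ ⋯ ∘ φ_{rₙ}` of the maps given by the first `n` symbols of `s`. -/
def simComp (ρ : ℝ) {k : ℕ} (s : SymSeq k) : ℕ → ℝ → ℝ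
  | 0 => id
  | n + 1 => simComp ρ s n ∘ simMap ρ ((s n : ℕ) + 1)

/-- The nonzero integers. -/
abbrev NonzeroInt : Type := {j : ℤ // j ≠ 0}

/-- The map `π(j, s)` equal to `ρ ^ (-j-1) π₋₁(s)` for `j < 0` and `1 - ρ ^ (j-1) π₋₁(s)` for
`j > 0`, where `π₋₁ = code`. -/
def fullCode (ρ : ℝ) {k : ℕ} (code : SymSeq k → ℝ) (q : NonzeroInt × SymSeq k) : ℝ :=
  if (q.1 : ℤ) < 0 then ρ ^ (-(q.1 : ℤ) - 1) * code q.2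
  else 1 - ρ ^ ((q.1 : ℤ) - 1) * code q.2

/-- The infinite product measure `ℙ_β ⊗ ℙ_β' ⊗ ℙ_β ⊗ ℙ_β' ⊗ ⋯`. -/
def alternatingProduct {k : ℕ} (β β' : PMF (Fin k)) : Measure (SymSeq k) :=
  Measure.infinitePi fun n : ℕ => (if Even n then β else β').toMeasure

/-- The measure `∑_j η_j δ_j ⊗ ν_j` on `ℤ* × {1, …, k}^ℕ`, where for `j < 0` one has
`η_j = c₋ η₋ ^ (-j)`, `ν_j = ℙ_β₋ ⊗ ℙ_β₊ ⊗ ⋯`, and for `j > 0` one has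
`η_j = c₊ η₊ ^ j`, `ν_j = ℙ_β₊ ⊗ ℙ_β₋ ⊗ ⋯`. -/
def symbolicMeasure {k : ℕ} (cm cp ηm ηp : ℝ) (βm βp : PMF (Fin k)) :
    Measure (NonzeroInt × SymSeq k) :=
  Measure.sum fun j : NonzeroInt =>
    if (j : ℤ) < 0 then
      ENNReal.ofReal (cm * ηm ^ (-(j : ℤ))) • (Measure.dirac j).prod (alternatingProduct βm βp)
    else
      ENNReal.ofReal (cp * ηp ^ (j : ℤ)) • (Measure.dirac j).prod (alternatingProduct βp βm)

end

/-!
Write `ρ` for the slope of `f₋` at `0` and `u = f₋(x₋)`. Symmetry and resonance make the other slope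
equal to `ρ ^ (-k)`, and on the sets `ρ ^ n I`, `n ≥ 0`, where `I = [ρ(1 - u), u]`, the two maps act
combinatorially: `f₋` sends `ρ ^ n x` to `ρ ^ (n + 1) x`, while `f₊` sends it to `ρ ^ (n - k) x` if
`n ≥ k` and to the mirror image of `φ_{n + 1}(x)` if `n < k`. The right half of the interval is the
mirror image of the left one. Disjointness is `u < 1 / 2`, which says that the images `φ_r(I)` are
separated by gaps (`IsCodingParam.le_abs_codePoint_sub`).

*Stationarity* (`isStationary_map_fullCode`). Evaluated on a Borel set, the symbolic measure becomes a
geometric sum over the blocks `ρ ^ n I` and their mirror images. Inside the blocks the stationarity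
equation is the equation of `η₋` or `η₊`; on the first block it is the self-similarity of the
alternating product measure, which splits off its first symbol.

*Uniqueness* (`AMSystem.IsStationary.unique`). The difference of the distribution functions of two
stationary measures satisfies a maximum principle: a nearly maximal positive value at `x` propagates
to `f₋⁻ⁿ(x)`, which tends to the endpoint `1`, where the difference vanishes.

*Dimension* (`IsCodingParam.measureDimH_eq`). By strong separation, Hausdorff dimension can be read
off from cylinders. By the law of large numbers along the even and the odd coordinates, a typical
cylinder has more, respectively less, mass than the `t`-th power of its diameter according to the
sign of `dimDrift`, an affine function of `t` whose zero is the claimed dimension. For `t` above the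
zero, cylinders are efficient covers (`IsCodingParam.dimH_image_le`); for `t` below it, the mass
distribution principle applies (`IsCodingParam.le_dimH`).

For equal probabilities a cylinder has mass exactly the power `log η / log ρ` of its diameter, so
covering by cylinders bounds the dimension of the whole attractor, hence of the support. The
dimension is less than one because `η ^ (k + 1) - 2 η + 1 = 0 < ρ ^ (k + 1) - 2 ρ + 1`.
-/

/-! ### The coding map -/

/-- The exponent `r₁ + ⋯ + rₙ` of the contraction ratio `ρ ^ (r₁ + ⋯ + rₙ)` of
`φ_{r₁} ∘ ⋯ ∘ φ_{rₙ}`. -/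
def wordWeight {k : ℕ} (s : SymSeq k) (n : ℕ) : ℕ := ∑ i ∈ Finset.range n, ((s i : ℕ) + 1)

/-- The limit of `φ_{r₁} ∘ ⋯ ∘ φ_{rₙ}`, written as the series obtained by expanding the
composition at the point `0`. -/
noncomputable def codePoint (ρ : ℝ) {k : ℕ} (s : SymSeq k) : ℝ :=
  ∑' n, (-1) ^ n * ρ ^ (wordWeight s n + 1)

/-- The sequence `s` without its first `n` symbols. -/
def dropSeq {k : ℕ} (n : ℕ) (s : SymSeq k) : SymSeq k := fun i => s (i + n)

/-- The relations between `ρ`, `k` and `u = f₋(x₋)` that make `[ρ(1 - u), u]` invariant under the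
maps `φ_r` with pairwise disjoint images. -/
structure IsCodingParam (ρ u : ℝ) (k : ℕ) : Prop where
  pos : 0 < ρ
  lt_one : ρ < 1
  lt_half : u < 1 / 2
  fixed : ρ * (1 - ρ ^ k * (1 - u)) = u
  one_le : 1 ≤ k

section Coding

variable {ρ u : ℝ} {k : ℕ}

@[simp] lemma wordWeight_zero (s : SymSeq k) : wordWeight s 0 = 0 := rfl

lemma wordWeight_succ (s : SymSeq k) (n : ℕ) :
    wordWeight s (n + 1) = wordWeight s n + ((s n : ℕ) + 1) := Finset.sum_range_succ _ _

lemma wordWeight_succ' (s : SymSeq k) (n : ℕ) :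
    wordWeight s (n + 1) = wordWeight (dropSeq 1 s) n + ((s 0 : ℕ) + 1) :=
  Finset.sum_range_succ' _ _

lemma le_wordWeight (s : SymSeq k) (n : ℕ) : n ≤ wordWeight s n := by
  induction n with
  | zero => simp
  | succ n ih => rw [wordWeight_succ]; omega

lemma wordWeight_congr {s t : SymSeq k} {n : ℕ} (h : ∀ i < n, s i = t i) :
    wordWeight s n = wordWeight t n :=
  Finset.sum_congr rfl fun i hi => by rw [h i (Finset.mem_range.1 hi)]

lemma simComp_congr {s t : SymSeq k} {n : ℕ} (h : ∀ i < n, s i = t i) :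
    simComp ρ s n = simComp ρ t n := by
  induction n with
  | zero => rfl
  | succ n ih =>
    simp only [simComp]
    rw [ih fun i hi => h i (by omega), h n (by omega)]

lemma abs_simComp_sub (hρ : 0 < ρ) (s : SymSeq k) (n : ℕ) (x y : ℝ) :
    |simComp ρ s n x - simComp ρ s n y| = ρ ^ wordWeight s n * |x - y| := by
  induction n generalizing x y with
  | zero => simp [simComp]
  | succ n ih =>
    simp only [simComp, Function.comp_apply]
    rw [ih, wordWeight_succ, pow_add ρ, mul_assoc]
    congr 1
    have : simMap ρ ((s n : ℕ) + 1) x - simMap ρ ((s n : ℕ) + 1) y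
        = -(ρ ^ ((s n : ℕ) + 1) * (x - y)) := by simp only [simMap]; ring
    rw [this, abs_neg, abs_mul, abs_of_pos (by positivity)]

lemma abs_code_term_le (h0 : 0 < ρ) (h1 : ρ < 1) (s : SymSeq k) (n : ℕ) :
    |(-1) ^ n * ρ ^ (wordWeight s n + 1)| ≤ ρ ^ n := by
  rw [abs_mul, abs_pow, abs_neg, abs_one, one_pow, one_mul, abs_of_pos (by positivity)]
  exact pow_le_pow_of_le_one h0.le h1.le ((le_wordWeight s n).trans (Nat.le_succ _))

lemma codePoint_eq_simMap (h0 : 0 < ρ) (h1 : ρ < 1) (s : SymSeq k) :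
    codePoint ρ s = simMap ρ ((s 0 : ℕ) + 1) (codePoint ρ (dropSeq 1 s)) := by
  have hs : Summable fun n => (-1) ^ n * ρ ^ (wordWeight s n + 1) :=
    Summable.of_norm_bounded (summable_geometric_of_lt_one h0.le h1)
      fun n => abs_code_term_le h0 h1 s n
  rw [codePoint, hs.tsum_eq_zero_add, simMap, codePoint, ← tsum_mul_left, sub_eq_add_neg,
    ← tsum_neg]
  congr 1
  · simp
  · refine tsum_congr fun n => ?_
    rw [wordWeight_succ']
    ring

lemma simComp_codePoint (h0 : 0 < ρ) (h1 : ρ < 1) (s : SymSeq k) (n : ℕ) :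
    simComp ρ s n (codePoint ρ (dropSeq n s)) = codePoint ρ s := by
  induction n with
  | zero => rfl
  | succ n ih =>
    rw [← ih, codePoint_eq_simMap h0 h1 (dropSeq n s)]
    simp only [simComp, Function.comp_apply]
    have e : dropSeq 1 (dropSeq n s) = dropSeq (n + 1) s := by
      ext i; simp [dropSeq, add_assoc, add_comm 1 n]
    rw [e]
    simp [dropSeq]

lemma continuous_codePoint (h0 : 0 < ρ) (h1 : ρ < 1) :
    Continuous (codePoint ρ : SymSeq k → ℝ) := by
  refine continuous_tsum (fun n => ?_) (summable_geometric_of_lt_one h0.le h1)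
    fun n s => abs_code_term_le h0 h1 s n
  refine continuous_const.mul ?_
  have hc : Continuous fun s : SymSeq k => wordWeight s n :=
    continuous_finsetSum _ fun i _ =>
      (continuous_of_discreteTopology (f := fun a : Fin k => (a : ℕ) + 1)).comp
        (continuous_apply i)
  exact (continuous_of_discreteTopology (f := fun m : ℕ => ρ ^ (m + 1))).comp hc

lemma tendsto_simComp (h0 : 0 < ρ) (h1 : ρ < 1) (s : SymSeq k) (x : ℝ) :
    Tendsto (fun n => simComp ρ s n x) atTop (𝓝 (codePoint ρ s)) := by
  have hb : ∀ s : SymSeq k, |codePoint ρ s| ≤ ∑' n, ρ ^ n := fun s => by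
    rw [← Real.norm_eq_abs, codePoint]
    exact tsum_of_norm_bounded (summable_geometric_of_lt_one h0.le h1).hasSum
      fun n => abs_code_term_le h0 h1 s n
  rw [tendsto_iff_norm_sub_tendsto_zero]
  have hz : Tendsto (fun n : ℕ => ρ ^ n * (|x| + ∑' n, ρ ^ n)) atTop (𝓝 0) := by
    simpa using (tendsto_pow_atTop_nhds_zero_of_lt_one h0.le h1).mul_const (|x| + ∑' n, ρ ^ n)
  refine squeeze_zero (fun _ => norm_nonneg _) (fun n => ?_) hz
  rw [← simComp_codePoint h0 h1 s n, Real.norm_eq_abs, abs_simComp_sub h0]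
  gcongr ?_ * ?_
  · exact pow_le_pow_of_le_one h0.le h1.le (le_wordWeight s n)
  · exact (abs_sub _ _).trans (by gcongr; exact hb _)

namespace IsCodingParam

variable (h : IsCodingParam ρ u k)
include h

lemma pow_mul_le : ρ ^ k * (1 - u) ≤ u := by
  have hk : ρ ^ k ≤ ρ := pow_le_of_le_one h.pos.le h.lt_one.le (by have := h.one_le; omega)
  have h0 := h.pos
  have h1 := h.lt_one
  have h2 := h.fixed
  have hk0 : 0 < ρ ^ k := pow_pos h0 k
  have h3 : 0 < 1 - ρ * ρ ^ k := by nlinarith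
  have h4 : u * (1 - ρ * ρ ^ k) = ρ * (1 - ρ ^ k) := by linarith
  have : ρ ^ k * (1 - ρ * ρ ^ k) ≤ (u * (1 - ρ * ρ ^ k)) * (1 + ρ ^ k) := by
    rw [h4]; nlinarith
  have h5 : ρ ^ k ≤ u * (1 + ρ ^ k) := by
    by_contra hc
    push Not at hc
    nlinarith
  linarith

lemma left_le : ρ * (1 - u) ≤ u := by
  conv_rhs => rw [← h.fixed]
  have := h.pow_mul_le
  have := h.pos
  gcongr

lemma left_pos : 0 < ρ * (1 - u) := mul_pos h.pos (by linarith [h.lt_half])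

lemma u_pos : 0 < u := h.left_pos.trans_le h.left_le

lemma simMap_mem {r : ℕ} (hr : 1 ≤ r) (hrk : r ≤ k) {x : ℝ} (hx : x ∈ Icc (ρ * (1 - u)) u) :
    simMap ρ r x ∈ Icc (ρ * (1 - u)) u := by
  have h0 := h.pos
  have hu := h.u_pos
  have h1 : ρ ^ r ≤ ρ := pow_le_of_le_one h0.le h.lt_one.le (by omega)
  have h2 : ρ ^ k ≤ ρ ^ r := pow_le_pow_of_le_one h0.le h.lt_one.le hrk
  have h3 : 0 < ρ ^ r := by positivity
  have h4 := h.left_pos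
  constructor
  · have : ρ ^ r * x ≤ ρ * u := mul_le_mul h1 hx.2 (h4.le.trans hx.1) h0.le
    simp only [simMap]; linarith
  · have : ρ ^ k * (ρ * (1 - u)) ≤ ρ ^ r * x := mul_le_mul h2 hx.1 h4.le h3.le
    have := h.fixed
    simp only [simMap]; nlinarith

lemma codePoint_mem (s : SymSeq k) : codePoint ρ s ∈ Icc (ρ * (1 - u)) u := by
  have hm : ∀ n, simComp ρ s n u ∈ Icc (ρ * (1 - u)) u := by
    have : ∀ n, ∀ x ∈ Icc (ρ * (1 - u)) u, simComp ρ s n x ∈ Icc (ρ * (1 - u)) u := by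
      intro n
      induction n with
      | zero => exact fun x hx => hx
      | succ n ih =>
        exact fun x hx => ih _ (h.simMap_mem (by omega) (s n).2 hx)
    exact fun n => this n u ⟨h.left_le, le_rfl⟩
  exact isClosed_Icc.mem_of_tendsto (tendsto_simComp h.pos h.lt_one s u)
    (Eventually.of_forall hm)

lemma abs_codePoint_sub_le {s t : SymSeq k} {n : ℕ} (hst : ∀ i < n, s i = t i) :
    |codePoint ρ s - codePoint ρ t| ≤ ρ ^ wordWeight s n := by
  rw [← simComp_codePoint h.pos h.lt_one s n, ← simComp_codePoint h.pos h.lt_one t n,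
    ← simComp_congr hst, abs_simComp_sub h.pos]
  refine mul_le_of_le_one_right (pow_nonneg h.pos.le _) ?_
  have h1 := h.codePoint_mem (dropSeq n s)
  have h2 := h.codePoint_mem (dropSeq n t)
  have := h.left_pos
  have := h.lt_half
  rw [abs_le]
  constructor <;> linarith [h1.1, h1.2, h2.1, h2.2]

/-- Points whose codes first differ at the index `n` are separated by a fixed multiple of the
diameter of their common cylinder of order `n`. -/
lemma le_abs_codePoint_sub {s t : SymSeq k} {n : ℕ} (hst : ∀ i < n, s i = t i)
    (hn : s n ≠ t n) :
    ρ ^ k * (1 - 2 * u) * ρ ^ wordWeight s n ≤ |codePoint ρ s - codePoint ρ t| := by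
  have key : ∀ a b : ℕ, a < b → b < k → ∀ x ∈ Icc (ρ * (1 - u)) u, ∀ y ∈ Icc (ρ * (1 - u)) u,
      ρ ^ k * (1 - 2 * u) ≤ simMap ρ (b + 1) y - simMap ρ (a + 1) x := by
    intro a b hab hb x hx y hy
    have h0 := h.pos
    have h1 : ρ ^ (b + 1) ≤ ρ ^ (a + 2) := pow_le_pow_of_le_one h0.le h.lt_one.le (by omega)
    have h2 : ρ ^ k ≤ ρ ^ (a + 2) := pow_le_pow_of_le_one h0.le h.lt_one.le (by omega)
    have h3 : ρ ^ (b + 1) * y ≤ ρ ^ (a + 2) * u :=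
      mul_le_mul h1 hy.2 (h.left_pos.le.trans hy.1) (by positivity)
    have h4 : ρ ^ (a + 1) * (ρ * (1 - u)) ≤ ρ ^ (a + 1) * x := by gcongr; exact hx.1
    have h5 : ρ ^ k * (1 - 2 * u) ≤ ρ ^ (a + 2) * (1 - 2 * u) := by
      gcongr; linarith [h.lt_half]
    have h6 : ρ ^ (a + 1) * (ρ * (1 - u)) = ρ ^ (a + 2) * (1 - u) := by ring
    simp only [simMap]
    linarith
  rw [← simComp_codePoint h.pos h.lt_one s n, ← simComp_codePoint h.pos h.lt_one t n,
    ← simComp_congr hst, abs_simComp_sub h.pos, mul_comm]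
  refine mul_le_mul_of_nonneg_left ?_ (pow_nonneg h.pos.le _)
  have hx := h.codePoint_mem (dropSeq 1 (dropSeq n s))
  have hy := h.codePoint_mem (dropSeq 1 (dropSeq n t))
  rw [codePoint_eq_simMap h.pos h.lt_one (dropSeq n s),
    codePoint_eq_simMap h.pos h.lt_one (dropSeq n t)]
  have e : ∀ s : SymSeq k, dropSeq n s 0 = s n := fun s => by simp [dropSeq]
  rw [e, e]
  rcases lt_or_gt_of_ne hn with hlt | hlt
  · rw [abs_sub_comm]
    exact (key _ _ hlt (t n).2 _ hx _ hy).trans (le_abs_self _)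
  · exact (key _ _ hlt (s n).2 _ hy _ hx).trans (le_abs_self _)

end IsCodingParam

end Coding

/-! ### Alternating product measures -/

section AlternatingProduct

variable {k : ℕ}

/-- The set of sequences that agree with `s` in the first `n` symbols. -/
def seqCylinder (s : SymSeq k) (n : ℕ) : Set (SymSeq k) := {t | ∀ i < n, t i = s i}

/-- The common value of `alternatingProduct β β'` on the cylinder of order `n` of `s`. -/
noncomputable def cylinderMass (β β' : PMF (Fin k)) (s : SymSeq k) (n : ℕ) : ℝ≥0∞ :=
  ∏ i ∈ Finset.range n, (if Even i then β else β') (s i)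

instance (β β' : PMF (Fin k)) : IsProbabilityMeasure (alternatingProduct β β') := by
  unfold alternatingProduct; infer_instance

lemma seqCylinder_eq_pi (s : SymSeq k) (n : ℕ) :
    seqCylinder s n = Set.pi (Finset.range n) fun i => {s i} := by
  ext t; simp [seqCylinder]

lemma isClopen_seqCylinder (s : SymSeq k) (n : ℕ) : IsClopen (seqCylinder s n) := by
  rw [seqCylinder_eq_pi]
  exact ⟨isClosed_set_pi fun i _ => isClosed_discrete _,
    isOpen_set_pi (Finset.finite_toSet _) fun i _ => isOpen_discrete _⟩

lemma alternatingProduct_seqCylinder (β β' : PMF (Fin k)) (s : SymSeq k) (n : ℕ) :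
    alternatingProduct β β' (seqCylinder s n) = cylinderMass β β' s n := by
  rw [seqCylinder_eq_pi, alternatingProduct, Measure.infinitePi_pi _ fun i _ => .singleton _]
  exact Finset.prod_congr rfl fun i _ => PMF.toMeasure_apply_singleton _ _ (.singleton _)

/-- Splitting off the first symbol of an alternating product exchanges the two vectors. -/
lemma alternatingProduct_apply_eq_sum (β β' : PMF (Fin k)) {E : Set (SymSeq k)}
    (hE : MeasurableSet E) :
    alternatingProduct β β' E =
      ∑ a, β a * alternatingProduct β' β {w | (fun n => Nat.casesOn n a w : SymSeq k) ∈ E} := by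
  have hm : Measurable fun q : Fin k × SymSeq k =>
      (fun n => Nat.casesOn n q.1 q.2 : SymSeq k) := by
    refine measurable_pi_iff.2 fun n => ?_
    cases n with
    | zero => exact measurable_fst
    | succ n => exact (measurable_pi_apply n).comp measurable_snd
  have hmap : (β.toMeasure.prod (alternatingProduct β' β)).map
      (fun q : Fin k × SymSeq k => (fun n => Nat.casesOn n q.1 q.2 : SymSeq k))
      = alternatingProduct β β' := by
    refine Measure.eq_infinitePi _ fun s t ht => ?_
    classical
    rw [Measure.map_apply hm (.pi s.countable_toSet fun i _ => ht i)]
    let t' : ℕ → Set (Fin k) := fun i => if i ∈ s then t i else univ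
    obtain ⟨N, hN⟩ : ∃ N, s ⊆ Finset.range (N + 1) :=
      ⟨s.sup id, fun i hi => Finset.mem_range_succ_iff.2 (Finset.le_sup (f := id) hi)⟩
    have hset : (fun q : Fin k × SymSeq k => (fun n => Nat.casesOn n q.1 q.2 : SymSeq k)) ⁻¹'
        (Set.pi s t) = t' 0 ×ˢ Set.pi (Finset.range N) fun i => t' (i + 1) := by
      ext ⟨a, w⟩
      simp only [mem_preimage, Set.mem_pi, mem_prod, Finset.mem_coe, Finset.mem_range, t']
      constructor
      · intro h
        refine ⟨?_, fun i _ => ?_⟩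
        · split_ifs with h0
          · exact h 0 h0
          · trivial
        · split_ifs with h0
          · exact h (i + 1) h0
          · trivial
      · rintro ⟨h0, hs⟩ i hi
        cases i with
        | zero => simpa [hi] using h0
        | succ i =>
          have := hs i (by have := Finset.mem_range.1 (hN hi); omega)
          simpa [hi] using this
    have ht' : ∀ i, MeasurableSet (t' i) := fun i => (Set.toFinite _).measurableSet
    rw [hset, Measure.prod_prod, alternatingProduct,
      Measure.infinitePi_pi _ fun i _ => ht' (i + 1)]
    have hsub : ∏ i ∈ s, (if Even i then β else β').toMeasure (t i)
        = ∏ i ∈ Finset.range (N + 1), (if Even i then β else β').toMeasure (t' i) := by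
      rw [← Finset.prod_subset hN]
      · exact Finset.prod_congr rfl fun i hi => by simp [t', hi]
      · intro i _ hi
        simp [t', hi]
    rw [hsub, Finset.prod_range_succ', mul_comm]
    congr 1
    refine Finset.prod_congr rfl fun i _ => ?_
    by_cases hi : Even i <;> simp [hi, Nat.even_add_one]
  rw [← hmap, Measure.map_apply hm hE, Measure.prod_apply (hm hE), lintegral_fintype]
  refine Finset.sum_congr rfl fun a _ => ?_
  rw [PMF.toMeasure_apply_singleton _ _ (.singleton _), mul_comm]
  rfl

/-- The strong law of large numbers along one residue class of the coordinates modulo `2`. -/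
lemma ae_tendsto_average_coord (β β' : PMF (Fin k)) (e : ℕ) (γ : PMF (Fin k))
    (hγ : ∀ m, (if Even (2 * m + e) then β else β') = γ) (z : Fin k → ℝ) :
    ∀ᵐ s ∂alternatingProduct β β',
      Tendsto (fun n : ℕ => (∑ m ∈ Finset.range n, z (s (2 * m + e))) / n) atTop
        (𝓝 (∑ a, (γ a).toReal * z a)) := by
  have hz : Measurable z := measurable_of_countable z
  have hmap : ∀ i, (alternatingProduct β β').map (fun s => s i)
      = (if Even i then β else β').toMeasure := fun i => Measure.infinitePi_map_eval _ i
  have hid : ∀ m, ProbabilityTheory.IdentDistrib (fun s : SymSeq k => s (2 * m + e))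
      (fun s => s (2 * 0 + e)) (alternatingProduct β β') (alternatingProduct β β') := fun m =>
    ⟨(measurable_pi_apply _).aemeasurable, (measurable_pi_apply _).aemeasurable, by
      rw [hmap, hmap, hγ, hγ]⟩
  have hind : ProbabilityTheory.iIndepFun (fun (i : ℕ) (s : SymSeq k) => s i)
      (alternatingProduct β β') := ProbabilityTheory.iIndepFun_infinitePi
        (X := fun (_ : ℕ) (a : Fin k) => a) fun _ => measurable_id
  have hint : Integrable (fun s : SymSeq k => z (s (2 * 0 + e))) (alternatingProduct β β') := by
    refine Integrable.of_bound
      (hz.comp (measurable_pi_apply (2 * 0 + e))).aestronglyMeasurable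
      (∑ a, |z a|) (Eventually.of_forall fun s => ?_)
    exact Finset.single_le_sum (f := fun a => |z a|) (fun a _ => abs_nonneg _)
      (Finset.mem_univ _)
  have h := ProbabilityTheory.strong_law_ae_real
    (fun m (s : SymSeq k) => z (s (2 * m + e))) hint
    (fun i j hij => (hind.indepFun (by omega : 2 * i + e ≠ 2 * j + e)).comp hz hz)
    (fun m => (hid m).comp hz)
  have hE : ∫ s, z (s (2 * 0 + e)) ∂alternatingProduct β β' = ∑ a, (γ a).toReal * z a := by
    rw [← integral_map (φ := fun s : SymSeq k => s (2 * 0 + e)) (f := z)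
      (measurable_pi_apply _).aemeasurable hz.aestronglyMeasurable, hmap, hγ,
      PMF.integral_eq_sum]
    rfl
  rwa [hE] at h

lemma sum_range_two_mul {f : ℕ → ℝ} (n : ℕ) :
    ∑ i ∈ Finset.range (2 * n), f i
      = ∑ m ∈ Finset.range n, f (2 * m) + ∑ m ∈ Finset.range n, f (2 * m + 1) := by
  induction n with
  | zero => simp
  | succ n ih =>
    rw [mul_add, mul_one, Finset.sum_range_succ, Finset.sum_range_succ, ih,
      Finset.sum_range_succ, Finset.sum_range_succ]
    ring

/-- Additive functionals with negative mean drift are eventually negative. -/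
lemma ae_eventually_sum_neg (β β' : PMF (Fin k)) (z z' : Fin k → ℝ)
    (hneg : ∑ a, (β a).toReal * z a + ∑ a, (β' a).toReal * z' a < 0) :
    ∀ᵐ s ∂alternatingProduct β β', ∀ᶠ n in atTop,
      ∑ i ∈ Finset.range n, (if Even i then z else z') (s i) < 0 := by
  filter_upwards [ae_tendsto_average_coord β β' 0 β (fun m => by simp) z,
    ae_tendsto_average_coord β β' 1 β' (fun m => by simp) z'] with s h0 h1
  set m := ∑ a, (β a).toReal * z a + ∑ a, (β' a).toReal * z' a
  set S : ℕ → ℝ := fun n => ∑ i ∈ Finset.range n, (if Even i then z else z') (s i)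
  have hS2 : ∀ n, S (2 * n) = ∑ i ∈ Finset.range n, z (s (2 * i + 0))
      + ∑ i ∈ Finset.range n, z' (s (2 * i + 1)) := fun n => by
    simp only [S]
    rw [sum_range_two_mul]
    simp
  have hav : Tendsto (fun n : ℕ => S (2 * n) / n) atTop (𝓝 m) := by
    refine (h0.add h1).congr fun n => ?_
    rw [hS2, add_div]
  have hbot : Tendsto (fun n : ℕ => S (2 * n)) atTop atBot := by
    refine (hav.neg_mul_atTop hneg tendsto_natCast_atTop_atTop).congr' ?_
    filter_upwards [eventually_ne_atTop 0] with n hn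
    have : (n : ℝ) ≠ 0 := Nat.cast_ne_zero.2 hn
    field_simp
  obtain ⟨N, hN⟩ := eventually_atTop.1
    (hbot.eventually (eventually_lt_atBot (-∑ a, |z a|)))
  have hC : 0 ≤ ∑ a, |z a| := Finset.sum_nonneg fun a _ => abs_nonneg _
  refine eventually_atTop.2 ⟨2 * N, fun n hn => ?_⟩
  change S n < 0
  rcases Nat.even_or_odd' n with ⟨j, rfl | rfl⟩
  · linarith [hN j (by omega)]
  · have e : S (2 * j + 1) = S (2 * j) + z (s (2 * j)) := by
      simp only [S]
      rw [Finset.sum_range_succ]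
      simp
    have hz : z (s (2 * j)) ≤ ∑ a, |z a| := (le_abs_self _).trans
      (Finset.single_le_sum (f := fun a => |z a|) (fun a _ => abs_nonneg _) (Finset.mem_univ _))
    rw [e]
    linarith [hN j (by omega)]

end AlternatingProduct

/-! ### Dimension of coded product measures -/

section Dimension

variable {ρ u : ℝ} {k : ℕ}

/-- The mean of `log β(r) - t r log ρ` over two consecutive symbols. Its sign compares the mass of
a typical cylinder with the `t`-th power of its diameter. -/
noncomputable def dimDrift (ρ : ℝ) (β β' : PMF (Fin k)) (t : ℝ) : ℝ :=
  ∑ a, (β a).toReal * (Real.log (β a).toReal - t * ((a : ℕ) + 1) * Real.log ρ) +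
    ∑ a, (β' a).toReal * (Real.log (β' a).toReal - t * ((a : ℕ) + 1) * Real.log ρ)

lemma wordWeight_le (s : SymSeq k) (n : ℕ) : wordWeight s n ≤ k * n := by
  induction n with
  | zero => simp
  | succ n ih => rw [wordWeight_succ, mul_add]; have := (s n).2; omega

lemma cylinderMass_congr {β β' : PMF (Fin k)} {s t : SymSeq k} {n : ℕ}
    (h : ∀ i < n, s i = t i) : cylinderMass β β' s n = cylinderMass β β' t n :=
  Finset.prod_congr rfl fun i hi => by rw [h i (Finset.mem_range.1 hi)]

lemma cylinderMass_eq_exp {β β' : PMF (Fin k)} (hβ : ∀ a, β a ≠ 0) (hβ' : ∀ a, β' a ≠ 0)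
    (s : SymSeq k) (n : ℕ) :
    cylinderMass β β' s n = ENNReal.ofReal (Real.exp
      (∑ i ∈ Finset.range n, Real.log ((if Even i then β else β') (s i)).toReal)) := by
  rw [Real.exp_sum, ENNReal.ofReal_prod_of_nonneg fun i _ => (Real.exp_pos _).le, cylinderMass]
  refine Finset.prod_congr rfl fun i _ => ?_
  have h0 : (if Even i then β else β') (s i) ≠ 0 := by split_ifs; exacts [hβ _, hβ' _]
  have h1 : (if Even i then β else β') (s i) ≠ ∞ := PMF.apply_ne_top _ _
  rw [Real.exp_log (ENNReal.toReal_pos h0 h1), ENNReal.ofReal_toReal h1]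

lemma ofReal_pow_rpow_eq_exp (h0 : 0 < ρ) {t : ℝ} (ht : 0 ≤ t) (s : SymSeq k) (n : ℕ) :
    ENNReal.ofReal (ρ ^ wordWeight s n) ^ t = ENNReal.ofReal (Real.exp
      (∑ i ∈ Finset.range n, t * (((s i : ℕ) : ℝ) + 1) * Real.log ρ)) := by
  rw [ENNReal.ofReal_rpow_of_nonneg (by positivity) ht, Real.rpow_def_of_pos (by positivity),
    Real.log_pow, ← Finset.sum_mul, ← Finset.mul_sum]
  congr 2
  simp only [wordWeight]
  push_cast
  ring

lemma ae_eventually_cylinderMass_le (h0 : 0 < ρ) {β β' : PMF (Fin k)} (hβ : ∀ a, β a ≠ 0)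
    (hβ' : ∀ a, β' a ≠ 0) {t : ℝ} (ht : 0 ≤ t) (hneg : dimDrift ρ β β' t < 0) :
    ∀ᵐ s ∂alternatingProduct β β', ∀ᶠ n in atTop,
      cylinderMass β β' s n ≤ ENNReal.ofReal (ρ ^ wordWeight s n) ^ t := by
  filter_upwards [ae_eventually_sum_neg β β'
    (fun a => Real.log (β a).toReal - t * ((a : ℕ) + 1) * Real.log ρ)
    (fun a => Real.log (β' a).toReal - t * ((a : ℕ) + 1) * Real.log ρ) hneg] with s hs
  filter_upwards [hs] with n hn
  rw [cylinderMass_eq_exp hβ hβ', ofReal_pow_rpow_eq_exp h0 ht]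
  refine ENNReal.ofReal_le_ofReal (Real.exp_le_exp.2 (sub_nonpos.1 ?_))
  rw [← Finset.sum_sub_distrib]
  refine le_trans (le_of_eq (Finset.sum_congr rfl fun i _ => ?_)) hn.le
  split_ifs <;> rfl

lemma ae_eventually_le_cylinderMass (h0 : 0 < ρ) {β β' : PMF (Fin k)} (hβ : ∀ a, β a ≠ 0)
    (hβ' : ∀ a, β' a ≠ 0) {t : ℝ} (ht : 0 ≤ t) (hpos : 0 < dimDrift ρ β β' t) :
    ∀ᵐ s ∂alternatingProduct β β', ∀ᶠ n in atTop,
      ENNReal.ofReal (ρ ^ wordWeight s n) ^ t ≤ cylinderMass β β' s n := by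
  have hneg : ∑ a, (β a).toReal * (t * ((a : ℕ) + 1) * Real.log ρ - Real.log (β a).toReal) +
      ∑ a, (β' a).toReal * (t * ((a : ℕ) + 1) * Real.log ρ - Real.log (β' a).toReal) < 0 := by
    rw [← neg_pos]
    refine lt_of_lt_of_eq hpos ?_
    rw [neg_add, ← Finset.sum_neg_distrib, ← Finset.sum_neg_distrib, dimDrift]
    congr 1 <;> exact Finset.sum_congr rfl fun a _ => by ring
  filter_upwards [ae_eventually_sum_neg β β' _ _ hneg] with s hs
  filter_upwards [hs] with n hn
  rw [cylinderMass_eq_exp hβ hβ', ofReal_pow_rpow_eq_exp h0 ht]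
  refine ENNReal.ofReal_le_ofReal (Real.exp_le_exp.2 (sub_nonpos.1 ?_))
  rw [← Finset.sum_sub_distrib]
  refine le_trans (le_of_eq (Finset.sum_congr rfl fun i _ => ?_)) hn.le
  split_ifs <;> rfl

lemma isClosed_setOf_forall_ge {P : SymSeq k → ℕ → Prop}
    (hP : ∀ s t n, (∀ i < n, s i = t i) → P s n → P t n) (N : ℕ) :
    IsClosed {s | ∀ n ≥ N, P s n} := by
  simp only [Set.ofPred_forall]
  refine isClosed_iInter fun n => isClosed_iInter fun _ => ⟨isOpen_iff_mem_nhds.2 fun s hs => ?_⟩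
  filter_upwards [(isClopen_seqCylinder s n).isOpen.mem_nhds fun i _ => rfl] with t ht hPt
  exact hs (hP t s n ht hPt)

/-- The image of a set of sequences on which every long cylinder has mass at least the `t`-th power
of its diameter has dimension at most `t`: the cylinders of order `n` are efficient covers. -/
lemma IsCodingParam.dimH_image_le (h : IsCodingParam ρ u k) {β β' : PMF (Fin k)} {t : ℝ}
    (ht : 0 < t) {G : Set (SymSeq k)} {N : ℕ}
    (hG : ∀ s ∈ G, ∀ n ≥ N, ENNReal.ofReal (ρ ^ wordWeight s n) ^ t ≤ cylinderMass β β' s n) :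
    dimH (codePoint ρ '' G) ≤ ENNReal.ofReal t := by
  let P : ∀ n : ℕ, (Fin n → Fin k) → Set (SymSeq k) := fun n w => {s | ∀ i : Fin n, s i = w i}
  have hPm : ∀ n w, MeasurableSet (P n w) := fun n w => by
    simp only [P, Set.ofPred_forall]
    exact MeasurableSet.iInter fun i => measurableSet_eq_fun (measurable_pi_apply _)
      measurable_const
  have hdiam : ∀ n w, ∀ s ∈ P n w,
      Metric.ediam (codePoint ρ '' (G ∩ P n w)) ≤ ENNReal.ofReal (ρ ^ wordWeight s n) := by
    intro n w s hs
    refine Metric.ediam_le ?_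
    rintro _ ⟨a, ha, rfl⟩ _ ⟨b, hb, rfl⟩
    rw [edist_dist, Real.dist_eq]
    refine ENNReal.ofReal_le_ofReal ?_
    rw [wordWeight_congr (t := a) fun i hi => (hs ⟨i, hi⟩).trans (ha.2 ⟨i, hi⟩).symm]
    exact h.abs_codePoint_sub_le fun i hi => (ha.2 ⟨i, hi⟩).trans (hb.2 ⟨i, hi⟩).symm
  have hH : μH[t] (codePoint ρ '' G) ≤ 1 := by
    refine (Measure.hausdorffMeasure_le_liminf_sum (l := atTop) t _
      (fun n : ℕ => ENNReal.ofReal (ρ ^ n)) ?_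
      (fun n w => codePoint ρ '' (G ∩ P n w)) ?_ ?_).trans ?_
    · simpa using ENNReal.tendsto_ofReal (tendsto_pow_atTop_nhds_zero_of_lt_one h.pos.le h.lt_one)
    · refine Eventually.of_forall fun n w => ?_
      rcases (G ∩ P n w).eq_empty_or_nonempty with he | ⟨s, hs⟩
      · simp [he]
      · exact (hdiam n w s hs.2).trans (ENNReal.ofReal_le_ofReal
          (pow_le_pow_of_le_one h.pos.le h.lt_one.le (le_wordWeight s n)))
    · refine Eventually.of_forall fun n => ?_
      rintro _ ⟨s, hs, rfl⟩
      exact mem_iUnion.2 ⟨fun i => s i, s, ⟨hs, fun i => rfl⟩, rfl⟩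
    · refine liminf_le_of_frequently_le' (Eventually.frequently ?_)
      filter_upwards [eventually_ge_atTop N] with n hn
      calc ∑ w, Metric.ediam (codePoint ρ '' (G ∩ P n w)) ^ t
          ≤ ∑ w, alternatingProduct β β' (P n w) := by
            refine Finset.sum_le_sum fun w _ => ?_
            rcases (G ∩ P n w).eq_empty_or_nonempty with he | ⟨s, hs⟩
            · simp [he, ht]
            · have hcyl : P n w = seqCylinder s n := by
                ext x
                exact ⟨fun hx i hi => (hx ⟨i, hi⟩).trans (hs.2 ⟨i, hi⟩).symm,
                  fun hx i => (hx i i.2).trans (hs.2 i)⟩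
              rw [hcyl, alternatingProduct_seqCylinder, ← hcyl]
              exact (ENNReal.rpow_le_rpow (hdiam n w s hs.2) ht.le).trans (hG s hs.1 n hn)
        _ ≤ 1 := by
            rw [← measure_univ (μ := alternatingProduct β β')]
            refine sum_measure_le_measure_univ (fun w _ => (hPm n w).nullMeasurableSet)
              fun w _ w' _ hne => Disjoint.aedisjoint (Set.disjoint_left.2 fun s hs hs' => ?_)
            exact hne (funext fun i => (hs i).symm.trans (hs' i))
  have hfin : μH[((Real.toNNReal t : NNReal) : ℝ)] (codePoint ρ '' G) ≠ ∞ := by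
    rw [Real.coe_toNNReal t ht.le]
    exact (hH.trans_lt ENNReal.one_lt_top).ne
  exact dimH_le_of_hausdorffMeasure_ne_top hfin

lemma IsCodingParam.exists_dimH_le (h : IsCodingParam ρ u k) {β β' : PMF (Fin k)}
    (hβ : ∀ a, β a ≠ 0) (hβ' : ∀ a, β' a ≠ 0) {t : ℝ} (ht : 0 < t)
    (hpos : 0 < dimDrift ρ β β' t) :
    ∃ D : Set ℝ, MeasurableSet D ∧ dimH D ≤ ENNReal.ofReal t ∧
      alternatingProduct β β' (codePoint ρ ⁻¹' Dᶜ) = 0 := by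
  let G : ℕ → Set (SymSeq k) := fun N =>
    {s | ∀ n ≥ N, ENNReal.ofReal (ρ ^ wordWeight s n) ^ t ≤ cylinderMass β β' s n}
  have hGc : ∀ N, IsClosed (G N) := fun N => isClosed_setOf_forall_ge
    (fun s t n hst hP => by rwa [← wordWeight_congr hst, ← cylinderMass_congr hst]) N
  refine ⟨⋃ N, codePoint ρ '' G N, MeasurableSet.iUnion fun N =>
    ((hGc N).isCompact.image (continuous_codePoint h.pos h.lt_one)).measurableSet, ?_, ?_⟩
  · rw [dimH_iUnion]
    exact iSup_le fun N => h.dimH_image_le ht fun s hs => hs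
  · refine measure_mono_null ?_ (ae_iff.1 (ae_eventually_le_cylinderMass h.pos hβ hβ' ht.le hpos))
    intro s hs hev
    obtain ⟨N, hN⟩ := eventually_atTop.1 hev
    exact hs (mem_iUnion.2 ⟨N, s, hN, rfl⟩)

/-- Mass distribution principle for the coded measure: strong separation forces a small set to lie
in a cylinder of comparable diameter. -/
lemma IsCodingParam.le_dimH (h : IsCodingParam ρ u k) {β β' : PMF (Fin k)}
    (hβ : ∀ a, β a ≠ 0) (hβ' : ∀ a, β' a ≠ 0) {t : ℝ} (ht : 0 < t)
    (hneg : dimDrift ρ β β' t < 0) {E : Set ℝ} (hE : MeasurableSet E)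
    (hfull : alternatingProduct β β' (codePoint ρ ⁻¹' Eᶜ) = 0) :
    ENNReal.ofReal t ≤ dimH E := by
  set A := alternatingProduct β β'
  have hcm : Measurable (codePoint ρ : SymSeq k → ℝ) :=
    (continuous_codePoint h.pos h.lt_one).measurable
  let G : ℕ → Set (SymSeq k) := fun N =>
    {s | ∀ n ≥ N, cylinderMass β β' s n ≤ ENNReal.ofReal (ρ ^ wordWeight s n) ^ t}
  have hGm : ∀ N, MeasurableSet (G N) := fun N => (isClosed_setOf_forall_ge
    (fun s t n hst hP => by rwa [← wordWeight_congr hst, ← cylinderMass_congr hst])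
    N).measurableSet
  obtain ⟨N, hN⟩ : ∃ N, A (G N) ≠ 0 := by
    by_contra! hc
    have h1 : A (⋃ N, G N) = 0 := measure_iUnion_null hc
    have h2 : A (⋃ N, G N)ᶜ = 0 := by
      refine measure_mono_null ?_
        (ae_iff.1 (ae_eventually_cylinderMass_le h.pos hβ hβ' ht.le hneg))
      intro s hs hev
      obtain ⟨N, hN⟩ := eventually_atTop.1 hev
      exact hs (mem_iUnion.2 ⟨N, hN⟩)
    have h3 := measure_union_le (μ := A) (⋃ N, G N) (⋃ N, G N)ᶜ
    rw [union_compl_self, h1, h2, measure_univ] at h3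
    simp at h3
  set δ := ρ ^ k * (1 - 2 * u)
  have hδ : 0 < δ := mul_pos (pow_pos h.pos k) (by linarith [h.lt_half])
  set m := (A.restrict (G N)).map (codePoint ρ)
  set c := ENNReal.ofReal δ ^ t
  have hc0 : c ≠ 0 := by
    simp only [c, ne_eq, ENNReal.rpow_eq_zero_iff, ENNReal.ofReal_eq_zero, not_or]
    exact ⟨fun hh => by linarith [hh.1], fun hh => by simp at hh⟩
  have hρN : 0 < ρ ^ (k * N) := pow_pos h.pos _
  have hle : c • m ≤ μH[t] := by
    refine Measure.le_hausdorffMeasure t (c • m) (ENNReal.ofReal (δ * ρ ^ (k * N) / 2))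
      (by simpa using by positivity) fun U hU => ?_
    rw [Measure.smul_apply, smul_eq_mul]
    have hmU : m U ≤ A (G N ∩ codePoint ρ ⁻¹' closure U) := by
      refine (measure_mono subset_closure).trans (le_of_eq ?_)
      rw [Measure.map_apply hcm isClosed_closure.measurableSet,
        Measure.restrict_apply (hcm isClosed_closure.measurableSet), inter_comm]
    rcases (G N ∩ codePoint ρ ⁻¹' closure U).eq_empty_or_nonempty with he | ⟨s, hsG, hsU⟩
    · rw [he, measure_empty, nonpos_iff_eq_zero] at hmU
      simp [hmU]
    by_cases hall : ∀ n, codePoint ρ ⁻¹' closure U ⊆ seqCylinder s n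
    · -- here the preimage is the single point `s`, which is not an atom
      have hz : A (G N ∩ codePoint ρ ⁻¹' closure U) = 0 := by
        have hlim : Tendsto (fun n : ℕ => ENNReal.ofReal (ρ ^ n) ^ t) atTop (𝓝 0) := by
          have := (ENNReal.tendsto_ofReal
            (tendsto_pow_atTop_nhds_zero_of_lt_one h.pos.le h.lt_one)).ennrpow_const t
          simpa [ht] using this
        refine nonpos_iff_eq_zero.1 (ge_of_tendsto hlim ?_)
        filter_upwards [eventually_ge_atTop N] with n hn
        calc A (G N ∩ codePoint ρ ⁻¹' closure U) ≤ A (seqCylinder s n) :=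
              measure_mono (inter_subset_right.trans (hall n))
          _ = cylinderMass β β' s n := alternatingProduct_seqCylinder _ _ _ _
          _ ≤ ENNReal.ofReal (ρ ^ wordWeight s n) ^ t := hsG n hn
          _ ≤ ENNReal.ofReal (ρ ^ n) ^ t := ENNReal.rpow_le_rpow (ENNReal.ofReal_le_ofReal
              (pow_le_pow_of_le_one h.pos.le h.lt_one.le (le_wordWeight s n))) ht.le
      rw [hz, nonpos_iff_eq_zero] at hmU
      simp [hmU]
    · push Not at hall
      classical
      -- `n + 1` is the least order at which the cylinder of `s` does not contain the preimage
      obtain ⟨n, hn, hn'⟩ : ∃ n, codePoint ρ ⁻¹' closure U ⊆ seqCylinder s n ∧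
          ¬ codePoint ρ ⁻¹' closure U ⊆ seqCylinder s (n + 1) := by
        have hpos : Nat.find hall ≠ 0 := fun h0 => by
          have := Nat.find_spec hall
          rw [h0] at this
          exact this fun x _ i hi => absurd hi (Nat.not_lt_zero i)
        obtain ⟨n, hn⟩ := Nat.exists_eq_succ_of_ne_zero hpos
        refine ⟨n, ?_, ?_⟩
        · by_contra hcon
          have := Nat.find_min' hall hcon
          omega
        · have := Nat.find_spec hall
          rwa [hn] at this
      obtain ⟨x, hxU, hx⟩ := Set.not_subset.1 hn'
      have hxs : ∀ i < n, s i = x i := fun i hi => (hn hxU i hi).symm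
      have hne : s n ≠ x n := fun he => hx fun i hi => by
        rcases Nat.lt_succ_iff_lt_or_eq.1 hi with hi | rfl
        · exact (hxs i hi).symm
        · exact he.symm
      have hsep : ENNReal.ofReal (δ * ρ ^ wordWeight s n) ≤ Metric.ediam U := by
        rw [← Metric.ediam_closure]
        refine le_trans ?_ (Metric.edist_le_ediam_of_mem hsU hxU)
        rw [edist_dist, Real.dist_eq]
        exact ENNReal.ofReal_le_ofReal (h.le_abs_codePoint_sub hxs hne)
      have hnN : N ≤ n := by
        by_contra! hlt
        have h1 := (ENNReal.ofReal_le_ofReal_iff (by positivity)).1 (hsep.trans hU)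
        have h2 : ρ ^ (k * N) ≤ ρ ^ wordWeight s n :=
          pow_le_pow_of_le_one h.pos.le h.lt_one.le
            ((wordWeight_le s n).trans (Nat.mul_le_mul_left k hlt.le))
        have h3 : δ * ρ ^ (k * N) ≤ δ * ρ ^ wordWeight s n := by gcongr
        have h4 : 0 < δ * ρ ^ (k * N) := by positivity
        linarith
      calc c * m U ≤ c * cylinderMass β β' s n := by
            gcongr
            rw [← alternatingProduct_seqCylinder]
            exact hmU.trans (measure_mono (inter_subset_right.trans hn))
        _ ≤ c * ENNReal.ofReal (ρ ^ wordWeight s n) ^ t := by gcongr; exact hsG n hnN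
        _ = ENNReal.ofReal (δ * ρ ^ wordWeight s n) ^ t := by
            rw [ENNReal.ofReal_mul hδ.le, ENNReal.mul_rpow_of_nonneg _ _ ht.le]
        _ ≤ Metric.ediam U ^ t := ENNReal.rpow_le_rpow hsep ht.le
  have hmE : m E ≠ 0 := by
    rw [Measure.map_apply hcm hE, Measure.restrict_apply (hcm hE)]
    intro h0
    refine hN (measure_mono_null (t := (codePoint ρ ⁻¹' E ∩ G N) ∪ codePoint ρ ⁻¹' Eᶜ)
      (fun s hs => ?_) (measure_union_null h0 hfull))
    by_cases hsE : codePoint ρ s ∈ E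
    · exact Or.inl ⟨hsE, hs⟩
    · exact Or.inr hsE
  have hne : μH[((Real.toNNReal t : NNReal) : ℝ)] E ≠ 0 := by
    rw [Real.coe_toNNReal t ht.le]
    intro h0
    have := hle E
    rw [h0, nonpos_iff_eq_zero, Measure.smul_apply, smul_eq_mul, mul_eq_zero] at this
    exact this.elim hc0 hmE
  exact le_dimH_of_hausdorffMeasure_ne_zero hne

end Dimension

/-! ### Alsedà–Misiurewicz maps and uniqueness of the stationary measure -/

namespace AMSystem

variable (S : AMSystem)

lemma am_lt_bm : S.am < S.bm := S.am_lt_one.trans S.one_lt_bm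

lemma ap_lt_bp : S.ap < S.bp := S.ap_lt_one.trans S.one_lt_bp

lemma xMinus_pos : 0 < S.xMinus :=
  div_pos (sub_pos.2 S.one_lt_bm) (sub_pos.2 S.am_lt_bm)

lemma xMinus_lt_one : S.xMinus < 1 := by
  rw [xMinus, div_lt_one (sub_pos.2 S.am_lt_bm)]
  linarith [S.am_lt_one]

lemma xPlus_pos : 0 < S.xPlus :=
  div_pos (sub_pos.2 S.ap_lt_one) (sub_pos.2 S.ap_lt_bp)

lemma xPlus_lt_one : S.xPlus < 1 := by
  rw [xPlus, div_lt_one (sub_pos.2 S.ap_lt_bp)]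
  linarith [S.one_lt_bp]

lemma fMinus_eq_max (x : ℝ) : S.fMinus x = max (S.am * x) (1 - S.bm * (1 - x)) := by
  have h := sub_pos.2 S.am_lt_bm
  unfold fMinus xMinus
  split_ifs with hx
  · rw [le_div_iff₀ h] at hx
    rw [max_eq_left]; linarith
  · rw [le_div_iff₀ h] at hx
    rw [max_eq_right]; linarith

lemma fPlus_eq_min (x : ℝ) : S.fPlus x = min (S.bp * x) (1 - S.ap * (1 - x)) := by
  have h := sub_pos.2 S.ap_lt_bp
  unfold fPlus xPlus
  split_ifs with hx
  · rw [le_div_iff₀ h] at hx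
    rw [min_eq_left]; linarith
  · rw [le_div_iff₀ h] at hx
    rw [min_eq_right]; linarith

lemma continuous_fMinus : Continuous S.fMinus := by
  rw [funext S.fMinus_eq_max]; fun_prop

lemma continuous_fPlus : Continuous S.fPlus := by
  rw [funext S.fPlus_eq_min]; fun_prop

lemma strictMono_fMinus : StrictMono S.fMinus := by
  rw [funext S.fMinus_eq_max]
  intro x y hxy
  have h1 := mul_lt_mul_of_pos_left hxy S.am_pos
  have h2 := mul_lt_mul_of_pos_left hxy (zero_lt_one.trans S.one_lt_bm)
  exact max_lt_max h1 (by linarith)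

lemma strictMono_fPlus : StrictMono S.fPlus := by
  rw [funext S.fPlus_eq_min]
  intro x y hxy
  have h1 := mul_lt_mul_of_pos_left hxy S.ap_pos
  have h2 := mul_lt_mul_of_pos_left hxy (zero_lt_one.trans S.one_lt_bp)
  exact min_lt_min h2 (by linarith)

/-- The inverse of `f₋` moves points of `[a, 1 - a]` to the right by a definite amount. -/
lemma exists_fMinus_eq {a : ℝ} (ha : 0 < a) :
    ∃ c > 0, ∀ x, a ≤ x → x ≤ 1 - a → ∃ y, S.fMinus y = x ∧ x + c ≤ y := by
  have h0 := S.am_pos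
  have h1 := S.am_lt_one
  have h2 := S.one_lt_bm
  have h3 : 0 < S.am⁻¹ - 1 := sub_pos.2 (one_lt_inv_iff₀.2 ⟨h0, h1⟩)
  have h4 : 0 < 1 - S.bm⁻¹ := sub_pos.2 (inv_lt_one_of_one_lt₀ h2)
  refine ⟨min (a * (S.am⁻¹ - 1)) (a * (1 - S.bm⁻¹)), lt_min (by positivity) (by positivity),
    fun x hx hx' => ⟨min (S.am⁻¹ * x) (1 - S.bm⁻¹ * (1 - x)), ?_, ?_⟩⟩
  · have e1 : S.am * (S.am⁻¹ * x) = x := by field_simp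
    have e2 : 1 - S.bm * (1 - (1 - S.bm⁻¹ * (1 - x))) = x := by field_simp; ring
    rw [fMinus_eq_max]
    rcases le_total (S.am⁻¹ * x) (1 - S.bm⁻¹ * (1 - x)) with h | h
    · rw [min_eq_left h, e1, max_eq_left]
      have := mul_le_mul_of_nonneg_left h (zero_lt_one.trans h2).le
      linarith
    · rw [min_eq_right h, e2, max_eq_right]
      have := mul_le_mul_of_nonneg_left h h0.le
      linarith
  · refine le_min ?_ ?_
    · have := mul_le_mul_of_nonneg_right hx h3.le
      linarith [min_le_left (a * (S.am⁻¹ - 1)) (a * (1 - S.bm⁻¹))]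
    · have := mul_le_mul_of_nonneg_right (show a ≤ 1 - x by linarith) h4.le
      linarith [min_le_right (a * (S.am⁻¹ - 1)) (a * (1 - S.bm⁻¹))]

lemma surjective_fPlus : Function.Surjective S.fPlus := by
  intro y
  have h0 := S.ap_pos
  have h2 := zero_lt_one.trans S.one_lt_bp
  have e1 : S.bp * (S.bp⁻¹ * y) = y := by field_simp
  have e2 : 1 - S.ap * (1 - (1 - S.ap⁻¹ * (1 - y))) = y := by field_simp; ring
  refine ⟨max (S.bp⁻¹ * y) (1 - S.ap⁻¹ * (1 - y)), ?_⟩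
  rw [fPlus_eq_min]
  rcases le_total (S.bp⁻¹ * y) (1 - S.ap⁻¹ * (1 - y)) with h | h
  · rw [max_eq_right h, e2, min_eq_right]
    have := mul_le_mul_of_nonneg_left h h2.le
    linarith
  · rw [max_eq_left h, e1, min_eq_left]
    have := mul_le_mul_of_nonneg_left h h0.le
    linarith

variable {S} {pm pp : ℝ}

lemma IsStationary.real_Iic_fMinus {ν : Measure ℝ} (h : S.IsStationary pm pp ν) (hpm : 0 < pm)
    (hpp : 0 < pp) {y z : ℝ} (hyz : S.fPlus z = S.fMinus y) :
    ν.real (Iic (S.fMinus y)) = pm * ν.real (Iic y) + pp * ν.real (Iic z) := by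
  have := h.prob
  have e1 : S.fMinus ⁻¹' Iic (S.fMinus y) = Iic y := by
    ext x; simp [S.strictMono_fMinus.le_iff_le]
  have e2 : S.fPlus ⁻¹' Iic (S.fMinus y) = Iic z := by
    ext x; simp [← hyz, S.strictMono_fPlus.le_iff_le]
  have hν : ν (Iic (S.fMinus y))
      = ENNReal.ofReal pm * ν (Iic y) + ENNReal.ofReal pp * ν (Iic z) := by
    conv_lhs => rw [h.stationary]
    rw [Measure.add_apply, Measure.smul_apply, Measure.smul_apply,
      Measure.map_apply S.continuous_fMinus.measurable measurableSet_Iic,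
      Measure.map_apply S.continuous_fPlus.measurable measurableSet_Iic, e1, e2]
    rfl
  rw [measureReal_def, hν, ENNReal.toReal_add (by finiteness) (by finiteness),
    ENNReal.toReal_mul, ENNReal.toReal_mul, ENNReal.toReal_ofReal hpm.le,
    ENNReal.toReal_ofReal hpp.le]
  rfl

lemma IsStationary.exists_forall_Icc {ν : Measure ℝ} (h : S.IsStationary pm pp ν) {ε : ℝ}
    (hε : 0 < ε) : ∃ a₀ > 0, ∀ a ≤ a₀, 1 - ε < ν.real (Icc a (1 - a)) := by
  have := h.prob
  have hU : ν (⋃ n : ℕ, Icc (1 / ((n : ℝ) + 1)) (1 - 1 / ((n : ℝ) + 1))) = 1 := by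
    refine (prob_compl_eq_zero_iff (MeasurableSet.iUnion fun _ => measurableSet_Icc)).1 ?_
    refine measure_mono_null (t := (Icc 0 1)ᶜ ∪ {0, 1}) (fun x hx => ?_)
      (measure_union_null h.concentrated h.endpoints)
    by_contra hcon
    simp only [mem_union, mem_compl_iff, not_or, not_not, mem_insert_iff, mem_singleton_iff,
      mem_Icc] at hcon
    obtain ⟨⟨h0, h1⟩, h2, h3⟩ := hcon
    have h0' : 0 < x := lt_of_le_of_ne h0 (Ne.symm h2)
    have h1' : 0 < 1 - x := sub_pos.2 (lt_of_le_of_ne h1 h3)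
    obtain ⟨n, hn⟩ := exists_nat_one_div_lt (lt_min h0' h1')
    refine hx (mem_iUnion.2 ⟨n, ?_, ?_⟩)
    · exact (hn.trans_le (min_le_left _ _)).le
    · linarith [hn.trans_le (min_le_right _ _)]
  have hmono : Monotone fun n : ℕ => Icc (1 / ((n : ℝ) + 1)) (1 - 1 / ((n : ℝ) + 1)) := by
    intro m n hmn
    have : 1 / ((n : ℝ) + 1) ≤ 1 / ((m : ℝ) + 1) := Nat.one_div_le_one_div hmn
    exact Icc_subset_Icc this (by linarith)
  have hlim := tendsto_measure_iUnion_atTop (μ := ν) hmono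
  rw [hU] at hlim
  have hlim' := (ENNReal.tendsto_toReal ENNReal.one_ne_top).comp hlim
  obtain ⟨n, hn⟩ := (hlim'.eventually (lt_mem_nhds (show 1 - ε < (1 : ℝ≥0∞).toReal by
    simpa using hε))).exists
  exact ⟨1 / ((n : ℝ) + 1), by positivity, fun a ha => lt_of_lt_of_le hn
    (measureReal_mono (Icc_subset_Icc ha (by linarith)))⟩

/-- Maximum principle: `h(x) = ν₁(-∞, x] - ν₂(-∞, x]` satisfies
`h(f₋ y) = p₋ h(y) + p₊ h(z)` with `f₊ z = f₋ y`, and is small near the endpoints. If `h` almost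
attains a positive supremum at `x`, then also at the points `f₋⁻ⁿ x`, which approach `1`. -/
lemma IsStationary.real_Iic_le {ν₁ ν₂ : Measure ℝ} (h₁ : S.IsStationary pm pp ν₁)
    (h₂ : S.IsStationary pm pp ν₂) (hpm : 0 < pm) (hpp : 0 < pp) (hsum : pm + pp = 1) (x : ℝ) :
    ν₁.real (Iic x) ≤ ν₂.real (Iic x) := by
  have := h₁.prob
  have := h₂.prob
  set h : ℝ → ℝ := fun x => ν₁.real (Iic x) - ν₂.real (Iic x) with hh
  have hbdd : BddAbove (range h) := ⟨1, by
    rintro _ ⟨x, rfl⟩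
    have h1 : ν₁.real (Iic x) ≤ 1 := measureReal_le_one
    have h2 : 0 ≤ ν₂.real (Iic x) := measureReal_nonneg
    simp only [hh]; linarith⟩
  set M := ⨆ x, h x
  have hM : ∀ x, h x ≤ M := le_ciSup hbdd
  by_contra! hx
  have hMpos : 0 < M := (sub_pos.2 hx).trans_le (hM x)
  obtain ⟨a₁, ha₁, H₁⟩ := h₁.exists_forall_Icc (half_pos hMpos)
  obtain ⟨a₂, ha₂, H₂⟩ := h₂.exists_forall_Icc (half_pos hMpos)
  set a := min a₁ a₂
  have ha : 0 < a := lt_min ha₁ ha₂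
  have hleft : ∀ x, x < a → h x ≤ M / 2 := fun x hxa => by
    have e : ν₁.real (Iic x) + ν₁.real (Icc a (1 - a)) ≤ 1 := by
      rw [← measureReal_union _ measurableSet_Icc]
      · exact measureReal_le_one
      · exact Set.disjoint_left.2 fun y hy hy' => by
          have := mem_Iic.1 hy; linarith [hy'.1]
    have h2 : 0 ≤ ν₂.real (Iic x) := measureReal_nonneg
    have := H₁ a (min_le_left _ _)
    simp only [hh]; linarith
  have hright : ∀ x, 1 - a ≤ x → h x ≤ M / 2 := fun x hxa => by
    have e : ν₂.real (Icc a (1 - a)) ≤ ν₂.real (Iic x) :=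
      measureReal_mono fun y hy => hy.2.trans hxa
    have h2 : ν₁.real (Iic x) ≤ 1 := measureReal_le_one
    have := H₂ a (min_le_right _ _)
    simp only [hh]; linarith
  obtain ⟨c, hc, hstep⟩ := S.exists_fMinus_eq ha
  have hind : ∀ n : ℕ, ∀ x, 1 - a - n * c ≤ x → h x ≤ M - pm ^ n * (M / 2) := by
    intro n
    induction n with
    | zero =>
      intro x hx
      have := hright x (by simpa using hx)
      simp; linarith
    | succ n ih =>
      intro x hx
      have hp1 : pm ^ (n + 1) ≤ 1 := pow_le_one₀ hpm.le (by linarith)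
      have hle : M / 2 ≤ M - pm ^ (n + 1) * (M / 2) := by nlinarith
      rcases lt_or_ge x a with hxa | hxa
      · exact (hleft x hxa).trans hle
      rcases le_or_gt (1 - a) x with hxb | hxb
      · exact (hright x hxb).trans hle
      obtain ⟨y, hy, hxy⟩ := hstep x hxa hxb.le
      obtain ⟨z, hz⟩ := S.surjective_fPlus (S.fMinus y)
      have e1 := h₁.real_Iic_fMinus hpm hpp hz
      have e2 := h₂.real_Iic_fMinus hpm hpp hz
      rw [hy] at e1 e2
      have hy' := ih y (by push_cast at hx; linarith)
      have e : h x = pm * h y + pp * h z := by simp only [hh]; rw [e1, e2]; ring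
      have i1 := mul_le_mul_of_nonneg_left hy' hpm.le
      have i2 := mul_le_mul_of_nonneg_left (hM z) hpp.le
      rw [e, pow_succ]
      have : pp = 1 - pm := by linarith
      subst this
      linarith
  obtain ⟨n, hn⟩ := exists_nat_gt (1 / c)
  have hnc : 1 < n * c := by rwa [div_lt_iff₀ hc] at hn
  have hpn : 0 < pm ^ n := pow_pos hpm n
  have : M ≤ M - pm ^ n * (M / 2) := ciSup_le fun x => by
    rcases lt_or_ge x a with hxa | hxa
    · have hp1 : pm ^ n ≤ 1 := pow_le_one₀ hpm.le (by linarith)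
      exact (hleft x hxa).trans (by nlinarith)
    · exact hind n x (by linarith)
  nlinarith

theorem IsStationary.unique {ν₁ ν₂ : Measure ℝ} (h₁ : S.IsStationary pm pp ν₁)
    (h₂ : S.IsStationary pm pp ν₂) (hpm : 0 < pm) (hpp : 0 < pp) (hsum : pm + pp = 1) :
    ν₁ = ν₂ := by
  have := h₁.prob
  have := h₂.prob
  refine Measure.ext_of_Iic _ _ fun x => ?_
  rw [← ENNReal.toReal_eq_toReal_iff' (by finiteness) (by finiteness)]
  exact le_antisymm (h₁.real_Iic_le h₂ hpm hpp hsum x) (h₂.real_Iic_le h₁ hpm hpp hsum x)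

/-! ### Endpoint derivatives and symmetry -/

variable (S)

lemma dMinus_zero : S.dMinus 0 = S.am := by
  have h : HasDerivWithinAt S.fMinus S.am (Icc 0 1) 0 := by
    refine (((hasDerivAt_id (0 : ℝ)).const_mul S.am).congr_of_eventuallyEq
      ?_).hasDerivWithinAt.congr_deriv (by simp)
    filter_upwards [Iio_mem_nhds S.xMinus_pos] with x hx
    exact if_pos hx.le
  exact h.derivWithin (uniqueDiffOn_Icc_zero_one 0 (by simp))

lemma dPlus_zero : S.dPlus 0 = S.bp := by
  have h : HasDerivWithinAt S.fPlus S.bp (Icc 0 1) 0 := by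
    refine (((hasDerivAt_id (0 : ℝ)).const_mul S.bp).congr_of_eventuallyEq
      ?_).hasDerivWithinAt.congr_deriv (by simp)
    filter_upwards [Iio_mem_nhds S.xPlus_pos] with x hx
    exact if_pos hx.le
  exact h.derivWithin (uniqueDiffOn_Icc_zero_one 0 (by simp))

lemma dMinus_one : S.dMinus 1 = S.bm := by
  have h : HasDerivWithinAt S.fMinus S.bm (Icc 0 1) 1 := by
    refine (((((hasDerivAt_id (1 : ℝ)).const_sub 1).const_mul S.bm).const_sub
      1).congr_of_eventuallyEq ?_).hasDerivWithinAt.congr_deriv (by simp)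
    filter_upwards [Ioi_mem_nhds S.xMinus_lt_one] with x hx
    exact if_neg (not_le.2 hx)
  exact h.derivWithin (uniqueDiffOn_Icc_zero_one 1 (by simp))

lemma dPlus_one : S.dPlus 1 = S.ap := by
  have h : HasDerivWithinAt S.fPlus S.ap (Icc 0 1) 1 := by
    refine (((((hasDerivAt_id (1 : ℝ)).const_sub 1).const_mul S.ap).const_sub
      1).congr_of_eventuallyEq ?_).hasDerivWithinAt.congr_deriv (by simp)
    filter_upwards [Ioi_mem_nhds S.xPlus_lt_one] with x hx
    exact if_neg (not_le.2 hx)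
  exact h.derivWithin (uniqueDiffOn_Icc_zero_one 1 (by simp))

variable {S}

lemma IsSymmetric.ap_eq_am (h : S.IsSymmetric) : S.ap = S.am := by
  obtain ⟨x, hx0, hx⟩ := exists_between
    (lt_min S.xMinus_pos (sub_pos.2 S.xPlus_lt_one))
  have hx1 := hx.trans_le (min_le_left _ _)
  have hx2 := hx.trans_le (min_le_right _ _)
  have e := h x ⟨hx0.le, (hx1.trans S.xMinus_lt_one).le⟩
  rw [fMinus, if_pos hx1.le, fPlus, if_neg (by linarith)] at e
  have : S.ap * x = S.am * x := by linarith
  exact mul_right_cancel₀ hx0.ne' this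

lemma IsSymmetric.bp_eq_bm (h : S.IsSymmetric) : S.bp = S.bm := by
  obtain ⟨x, hx0, hx⟩ := exists_between
    (lt_min S.xPlus_pos (sub_pos.2 S.xMinus_lt_one))
  have hx1 := hx.trans_le (min_le_left _ _)
  have hx2 := hx.trans_le (min_le_right _ _)
  have e := h (1 - x) ⟨by linarith [S.xPlus_lt_one], by linarith⟩
  rw [sub_sub_cancel, fMinus, if_neg (by linarith), fPlus, if_pos hx1.le] at e
  have : S.bp * x = S.bm * x := by linarith
  exact mul_right_cancel₀ hx0.ne' this

lemma IsSymmetric.fMinus_one_sub (h : S.IsSymmetric) (x : ℝ) :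
    S.fMinus (1 - x) = 1 - S.fPlus x := by
  rw [fMinus_eq_max, fPlus_eq_min, h.ap_eq_am, h.bp_eq_bm, sub_sub_cancel, max_comm]
  rcases le_total (S.bm * x) (1 - S.am * (1 - x)) with hx | hx
  · rw [min_eq_left hx, max_eq_left (by linarith)]
  · rw [min_eq_right hx, max_eq_right (by linarith)]; ring

lemma IsSymmetric.fPlus_one_sub (h : S.IsSymmetric) (x : ℝ) :
    S.fPlus (1 - x) = 1 - S.fMinus x := by
  have := h.fMinus_one_sub (1 - x)
  rw [sub_sub_cancel] at this
  linarith

/-- The consequences of symmetry, disjointness and resonance, expressed through the slopes. -/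
lemma IsSymmetric.isCodingParam (h : S.IsSymmetric) (hd : S.IsDisjointType) {k : ℕ} (hk : 1 ≤ k)
    (hres : S.am ^ k * S.bm = 1) : IsCodingParam S.am (S.fMinus S.xMinus) k := by
  have hpos := sub_pos.2 S.am_lt_bm
  have hb : 0 < S.bm := zero_lt_one.trans S.one_lt_bm
  have hu : S.fMinus S.xMinus = S.am * ((S.bm - 1) / (S.bm - S.am)) := if_pos le_rfl
  have hv : S.fPlus S.xPlus = 1 - S.fMinus S.xMinus := by
    have e : S.xPlus = 1 - S.xMinus := by
      rw [xPlus, xMinus, h.ap_eq_am, h.bp_eq_bm]; field_simp; ring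
    rw [e, h.fPlus_one_sub]
  refine ⟨S.am_pos, S.am_lt_one, ?_, ?_, hk⟩
  · rw [IsDisjointType, hv] at hd
    linarith
  · have hak : S.am ^ k = 1 / S.bm := by rw [eq_div_iff hb.ne', hres]
    rw [hak, hu]
    field_simp
    ring

end AMSystem

/-! ### The coded measure is stationary -/

section Stationary

variable {ρ : ℝ} {k : ℕ}

/-- The mass that `∑ₙ η ^ (n + 1) (x ↦ ρ ^ n x)_* (codePoint)_* ν` gives to `E`. -/
noncomputable def blockSum (ρ η : ℝ) (ν : Measure (SymSeq k)) (E : Set ℝ) : ℝ :=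
  ∑' n : ℕ, η ^ (n + 1) * ν.real {s | ρ ^ n * codePoint ρ s ∈ E}

lemma summable_blockSum {η : ℝ} (h0 : 0 < η) (h1 : η < 1) (ν : Measure (SymSeq k))
    [IsProbabilityMeasure ν] (F : ℕ → Set (SymSeq k)) :
    Summable fun n : ℕ => η ^ (n + 1) * ν.real (F n) := by
  refine Summable.of_nonneg_of_le (fun n => by positivity) (fun n => ?_)
    (summable_geometric_of_lt_one h0.le h1)
  calc η ^ (n + 1) * ν.real (F n) ≤ η ^ n * 1 :=
        mul_le_mul (pow_le_pow_of_le_one h0.le h1.le (Nat.le_succ n)) measureReal_le_one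
          measureReal_nonneg (by positivity)
    _ = η ^ n := mul_one _

lemma blockSum_nonneg {η : ℝ} (h0 : 0 < η) (ν : Measure (SymSeq k)) (E : Set ℝ) :
    0 ≤ blockSum ρ η ν E :=
  tsum_nonneg fun n => by positivity

/-- The nonzero integers as two copies of the natural numbers, `n ↦ -(n + 1)` and `n ↦ n + 1`. -/
def nonzeroIntEquiv : ℕ ⊕ ℕ ≃ NonzeroInt where
  toFun := Sum.elim (fun n => ⟨-((n : ℤ) + 1), by omega⟩) (fun n => ⟨(n : ℤ) + 1, by omega⟩)
  invFun j := if (j : ℤ) < 0 then Sum.inl (-(j : ℤ) - 1).toNat else Sum.inr ((j : ℤ) - 1).toNat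
  left_inv := by
    rintro (n | n)
    · have : -((n : ℤ) + 1) < 0 := by omega
      simp
      omega
    · have : ¬ ((n : ℤ) + 1 < 0) := by omega
      simp [this]
  right_inv := by
    rintro ⟨j, hj⟩
    by_cases h : j < 0
    · simp only [h, if_true, Sum.elim_inl, Subtype.mk.injEq]; omega
    · simp only [h, if_false, Sum.elim_inr, Subtype.mk.injEq]; omega

lemma measurable_fullCode {code : SymSeq k → ℝ} (hc : Measurable code) :
    Measurable (fullCode ρ code) := by
  have h1 : Measurable fun j : NonzeroInt => ρ ^ (-(j : ℤ) - 1) := measurable_of_countable _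
  have h2 : Measurable fun j : NonzeroInt => ρ ^ ((j : ℤ) - 1) := measurable_of_countable _
  have h3 : MeasurableSet {j : NonzeroInt | (j : ℤ) < 0} := (Set.to_countable _).measurableSet
  refine Measurable.ite (measurable_fst h3) ?_ ?_
  · exact (h1.comp measurable_fst).mul (hc.comp measurable_snd)
  · exact measurable_const.sub ((h2.comp measurable_fst).mul (hc.comp measurable_snd))

/-- The coded measure of a set, as the contributions of the left and of the right half of the
interval; the right half is the mirror image `x ↦ 1 - x` of a left half. -/
lemma map_fullCode_apply (h0 : 0 < ρ) (h1 : ρ < 1) {cm cp ηm ηp : ℝ} (hcm : 0 ≤ cm)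
    (hcp : 0 ≤ cp) (hm0 : 0 < ηm) (hm1 : ηm < 1) (hp0 : 0 < ηp) (hp1 : ηp < 1)
    (βm βp : PMF (Fin k)) {E : Set ℝ} (hE : MeasurableSet E) :
    (symbolicMeasure cm cp ηm ηp βm βp).map (fullCode ρ (codePoint ρ)) E =
      ENNReal.ofReal (cm * blockSum ρ ηm (alternatingProduct βm βp) E +
        cp * blockSum ρ ηp (alternatingProduct βp βm) ((fun x => 1 - x) ⁻¹' E)) := by
  have hc : Measurable (codePoint ρ : SymSeq k → ℝ) := (continuous_codePoint h0 h1).measurable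
  have hf := measurable_fullCode (ρ := ρ) hc
  rw [Measure.map_apply hf hE, symbolicMeasure, Measure.sum_apply _ (hf hE),
    ← nonzeroIntEquiv.tsum_eq, ENNReal.summable.tsum_sum ENNReal.summable,
    ENNReal.ofReal_add (mul_nonneg hcm (blockSum_nonneg hm0 _ _))
      (mul_nonneg hcp (blockSum_nonneg hp0 _ _)), blockSum, blockSum, ← tsum_mul_left,
    ← tsum_mul_left, ENNReal.ofReal_tsum_of_nonneg (fun n => by positivity)
      ((summable_blockSum hm0 hm1 _ _).mul_left cm),
    ENNReal.ofReal_tsum_of_nonneg (fun n => by positivity)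
      ((summable_blockSum hp0 hp1 _ _).mul_left cp)]
  congr 1
  · refine tsum_congr fun n => ?_
    have hlt : -((n : ℤ) + 1) < 0 := by omega
    simp only [nonzeroIntEquiv, Equiv.coe_fn_mk, Sum.elim_inl, hlt, if_true]
    rw [Measure.smul_apply, Measure.dirac_prod, Measure.map_apply measurable_prodMk_left (hf hE),
      smul_eq_mul, ← mul_assoc, ENNReal.ofReal_mul (p := cm * ηm ^ (n + 1)) (by positivity),
      ofReal_measureReal]
    congr 2
    ext s
    have e : -(-((n : ℤ) + 1)) - 1 = n := by ring
    simp only [mem_preimage, fullCode, hlt, if_true, e, zpow_natCast, Set.mem_ofPred_eq]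
  · refine tsum_congr fun n => ?_
    have hlt : ¬ ((n : ℤ) + 1 < 0) := by omega
    simp only [nonzeroIntEquiv, Equiv.coe_fn_mk, Sum.elim_inr, hlt, if_false]
    rw [Measure.smul_apply, Measure.dirac_prod, Measure.map_apply measurable_prodMk_left (hf hE),
      smul_eq_mul, ← mul_assoc, ENNReal.ofReal_mul (p := cp * ηp ^ (n + 1)) (by positivity),
      ofReal_measureReal]
    congr 2
    ext s
    have e : ((n : ℤ) + 1) - 1 = n := by ring
    simp only [mem_preimage, fullCode, hlt, if_false, e, zpow_natCast, Set.mem_ofPred_eq]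

/-- Self-similarity of the coded measure. -/
lemma alternatingProduct_real_codePoint (h0 : 0 < ρ) (h1 : ρ < 1) (β β' : PMF (Fin k))
    {E : Set ℝ} (hE : MeasurableSet E) :
    (alternatingProduct β β').real {s | codePoint ρ s ∈ E} =
      ∑ a, (β a).toReal *
        (alternatingProduct β' β).real {s | simMap ρ ((a : ℕ) + 1) (codePoint ρ s) ∈ E} := by
  have hc : Measurable (codePoint ρ : SymSeq k → ℝ) := (continuous_codePoint h0 h1).measurable
  have hset : MeasurableSet {s : SymSeq k | codePoint ρ s ∈ E} := hc hE
  rw [measureReal_def, alternatingProduct_apply_eq_sum β β' hset, ENNReal.toReal_sum fun a _ =>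
    ENNReal.mul_ne_top (PMF.apply_ne_top _ _) (by finiteness)]
  refine Finset.sum_congr rfl fun a _ => ?_
  rw [ENNReal.toReal_mul]
  congr 3
  ext w
  simp only [Set.mem_ofPred_eq]
  rw [codePoint_eq_simMap h0 h1]
  rfl

namespace IsCodingParam

variable {S : AMSystem} (h : IsCodingParam S.am (S.fMinus S.xMinus) k)
include h

lemma fMinus_mul_codePoint (n : ℕ) (s : SymSeq k) :
    S.fMinus (S.am ^ n * codePoint S.am s) = S.am ^ (n + 1) * codePoint S.am s := by
  have hx := h.codePoint_mem s
  have hu : S.fMinus S.xMinus = S.am * S.xMinus := if_pos le_rfl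
  have hle : S.am ^ n * codePoint S.am s ≤ S.xMinus := by
    calc S.am ^ n * codePoint S.am s ≤ 1 * codePoint S.am s :=
          mul_le_mul_of_nonneg_right (pow_le_one₀ h.pos.le h.lt_one.le)
            (h.left_pos.le.trans hx.1)
      _ ≤ S.am * S.xMinus := by rw [one_mul, ← hu]; exact hx.2
      _ ≤ S.xMinus := mul_le_of_le_one_left S.xMinus_pos.le h.lt_one.le
  rw [AMSystem.fMinus, if_pos hle, pow_succ]
  ring

lemma xPlus_eq (hsym : S.IsSymmetric) :
    S.xPlus = S.am ^ k * (1 - S.fMinus S.xMinus) := by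
  have hu : S.fMinus S.xMinus = S.am * S.xMinus := if_pos le_rfl
  have hpos := sub_pos.2 S.am_lt_bm
  have e : S.xPlus = 1 - S.xMinus := by
    rw [AMSystem.xPlus, AMSystem.xMinus, hsym.ap_eq_am, hsym.bp_eq_bm]; field_simp; ring
  have := h.fixed
  rw [hu] at this ⊢
  have h2 := mul_left_cancel₀ h.pos.ne' this
  linarith

lemma fPlus_mul_codePoint (hsym : S.IsSymmetric) (hres : S.am ^ k * S.bm = 1) (n : ℕ)
    (s : SymSeq k) : S.fPlus (S.am ^ (n + k) * codePoint S.am s) =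
      S.am ^ n * codePoint S.am s := by
  have hx := h.codePoint_mem s
  have hle : S.am ^ (n + k) * codePoint S.am s ≤ S.xPlus := by
    rw [h.xPlus_eq hsym]
    refine mul_le_mul (pow_le_pow_of_le_one h.pos.le h.lt_one.le (by omega)) ?_
      (h.left_pos.le.trans hx.1) (pow_nonneg h.pos.le _)
    linarith [hx.2, h.lt_half]
  rw [AMSystem.fPlus, if_pos hle, hsym.bp_eq_bm, pow_add]
  linear_combination S.am ^ n * codePoint S.am s * hres

lemma fPlus_mul_codePoint_of_lt (hsym : S.IsSymmetric) {n : ℕ}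
    (hn : n < k) (s : SymSeq k) : S.fPlus (S.am ^ n * codePoint S.am s) =
      1 - simMap S.am (n + 1) (codePoint S.am s) := by
  have hx := h.codePoint_mem s
  have hle : S.xPlus ≤ S.am ^ n * codePoint S.am s := by
    rw [h.xPlus_eq hsym]
    calc S.am ^ k * (1 - S.fMinus S.xMinus)
        ≤ S.am ^ (n + 1) * (1 - S.fMinus S.xMinus) := by
          refine mul_le_mul_of_nonneg_right
            (pow_le_pow_of_le_one h.pos.le h.lt_one.le hn) (by linarith [h.lt_half])
      _ = S.am ^ n * (S.am * (1 - S.fMinus S.xMinus)) := by ring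
      _ ≤ S.am ^ n * codePoint S.am s :=
          mul_le_mul_of_nonneg_left hx.1 (pow_nonneg h.pos.le _)
  have hval : S.fPlus (S.am ^ n * codePoint S.am s)
      = 1 - S.ap * (1 - S.am ^ n * codePoint S.am s) := by
    have hpos := sub_pos.2 S.ap_lt_bp
    rw [AMSystem.xPlus, div_le_iff₀ hpos] at hle
    rw [AMSystem.fPlus_eq_min, min_eq_right]
    linarith
  rw [hval, hsym.ap_eq_am, simMap]
  ring

lemma blockSum_fMinus {η : ℝ} (h0 : 0 < η) (h1 : η < 1) (ν : Measure (SymSeq k))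
    [IsProbabilityMeasure ν] (E : Set ℝ) :
    η * (blockSum S.am η ν (S.fMinus ⁻¹' E) + ν.real {s | codePoint S.am s ∈ E}) =
      blockSum S.am η ν E := by
  have e := (summable_blockSum h0 h1 ν fun n => {s | S.am ^ n * codePoint S.am s ∈ E})
  rw [blockSum, blockSum, e.tsum_eq_zero_add, mul_add, ← tsum_mul_left, add_comm]
  congr 1
  · simp
  · refine tsum_congr fun n => ?_
    simp only [mem_preimage, h.fMinus_mul_codePoint]
    ring

lemma blockSum_fPlus (hsym : S.IsSymmetric) (hres : S.am ^ k * S.bm = 1) {η : ℝ} (h0 : 0 < η)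
    (h1 : η < 1) (ν : Measure (SymSeq k)) [IsProbabilityMeasure ν] (E : Set ℝ) :
    blockSum S.am η ν (S.fPlus ⁻¹' E) =
      ∑ a : Fin k, η ^ ((a : ℕ) + 1) *
        ν.real {s | 1 - simMap S.am ((a : ℕ) + 1) (codePoint S.am s) ∈ E} +
      η ^ k * blockSum S.am η ν E := by
  have e := (summable_blockSum h0 h1 ν
    fun n => {s | S.am ^ n * codePoint S.am s ∈ S.fPlus ⁻¹' E})
  rw [blockSum, ← e.sum_add_tsum_nat_add k, Finset.sum_range, blockSum, ← tsum_mul_left]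
  congr 1
  · refine Finset.sum_congr rfl fun a _ => ?_
    simp only [mem_preimage, h.fPlus_mul_codePoint_of_lt hsym a.2]
  · refine tsum_congr fun n => ?_
    simp only [mem_preimage, h.fPlus_mul_codePoint hsym hres]
    ring

end IsCodingParam

/-- Stationarity of the coded measure. The masses of the blocks solve the recurrences
`p₋ + p₊ η₋ ^ (k + 1) = η₋` and `p₊ + p₋ η₊ ^ (k + 1) = η₊`, and what `f₊` (`f₋`) moves across the
middle reassembles, by self-similarity, the first block on the other side. -/
lemma isStationary_map_fullCode {S : AMSystem} {pm pp : ℝ} (hpm : 0 < pm) (hpp : 0 < pp)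
    (hsum : pm + pp = 1) (hsym : S.IsSymmetric)
    (h : IsCodingParam S.am (S.fMinus S.xMinus) k) (hres : S.am ^ k * S.bm = 1)
    {ηm ηp : ℝ} (hm0 : 0 < ηm) (hm1 : ηm < 1) (hp0 : 0 < ηp) (hp1 : ηp < 1)
    (hηm : pp * ηm ^ (k + 1) - ηm + pm = 0) (hηp : pm * ηp ^ (k + 1) - ηp + pp = 0)
    {βm βp : PMF (Fin k)}
    (hβm : ∀ i : Fin k, βm i = ENNReal.ofReal (pm / pp * ηp ^ ((i : ℕ) + 1)))
    (hβp : ∀ i : Fin k, βp i = ENNReal.ofReal (pp / pm * ηm ^ ((i : ℕ) + 1))) :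
    S.IsStationary pm pp ((symbolicMeasure
      (pp / (pp * (ηm / (1 - ηm)) + pm * (ηp / (1 - ηp))))
      (pm / (pp * (ηm / (1 - ηm)) + pm * (ηp / (1 - ηp))))
      ηm ηp βm βp).map (fullCode S.am (codePoint S.am))) := by
  set Z := pp * (ηm / (1 - ηm)) + pm * (ηp / (1 - ηp)) with hZ
  have hm1' : 0 < 1 - ηm := sub_pos.2 hm1
  have hp1' : 0 < 1 - ηp := sub_pos.2 hp1
  have hZ0 : 0 < Z := by positivity
  have hcm : 0 ≤ pp / Z := by positivity
  have hcp : 0 ≤ pm / Z := by positivity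
  have happ : ∀ {E : Set ℝ}, MeasurableSet E → _ := fun {E} hE =>
    map_fullCode_apply h.pos h.lt_one hcm hcp hm0 hm1 hp0 hp1 βm βp hE
  have hnn : ∀ E : Set ℝ, 0 ≤ pp / Z * blockSum S.am ηm (alternatingProduct βm βp) E +
      pm / Z * blockSum S.am ηp (alternatingProduct βp βm) ((fun x => 1 - x) ⁻¹' E) := fun E =>
    add_nonneg (mul_nonneg hcm (blockSum_nonneg hm0 _ _))
      (mul_nonneg hcp (blockSum_nonneg hp0 _ _))
  have hgeom : ∀ {η : ℝ}, 0 < η → η < 1 → ∀ (ν : Measure (SymSeq k)) [IsProbabilityMeasure ν]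
      (E : Set ℝ), (∀ n (s : SymSeq k), S.am ^ n * codePoint S.am s ∈ E) →
      blockSum S.am η ν E = η / (1 - η) := by
    intro η h0 h1 ν _ E hE
    simp only [blockSum, hE, Set.ofPred_true, probReal_univ, mul_one, pow_succ]
    rw [tsum_mul_right, tsum_geometric_of_lt_one h0.le h1, div_eq_inv_mul]
  have hzero : ∀ {η : ℝ} (ν : Measure (SymSeq k)) (E : Set ℝ),
      (∀ n (s : SymSeq k), S.am ^ n * codePoint S.am s ∉ E) → blockSum S.am η ν E = 0 := by
    intro η ν E hE
    simp [blockSum, hE]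
  have hmem : ∀ n (s : SymSeq k), S.am ^ n * codePoint S.am s ∈ Ioo (0 : ℝ) 1 := by
    intro n s
    have hx := h.codePoint_mem s
    have hpos : 0 < codePoint S.am s := h.left_pos.trans_le hx.1
    refine ⟨mul_pos (pow_pos h.pos n) hpos, ?_⟩
    calc S.am ^ n * codePoint S.am s ≤ 1 * codePoint S.am s :=
          mul_le_mul_of_nonneg_right (pow_le_one₀ h.pos.le h.lt_one.le) hpos.le
      _ < 1 := by linarith [hx.2, h.lt_half]
  refine ⟨⟨?_⟩, ?_, ?_, ?_⟩
  · rw [happ MeasurableSet.univ, preimage_univ, hgeom hm0 hm1 _ _ fun _ _ => mem_univ _,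
      hgeom hp0 hp1 _ _ fun _ _ => mem_univ _, ← ENNReal.ofReal_one]
    congr 1
    rw [div_mul_eq_mul_div, div_mul_eq_mul_div, ← add_div, ← hZ, div_self hZ0.ne']
  · rw [happ measurableSet_Icc.compl, hzero, hzero]
    · simp
    · intro n s hs
      have := hmem n s
      exact hs ⟨by linarith [this.2], by linarith [this.1]⟩
    · exact fun n s hs => hs (Ioo_subset_Icc_self (hmem n s))
  · ext E hE
    have hE1 := S.continuous_fMinus.measurable hE
    have hE2 := S.continuous_fPlus.measurable hE
    rw [Measure.add_apply, Measure.smul_apply, Measure.smul_apply,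
      Measure.map_apply S.continuous_fMinus.measurable hE,
      Measure.map_apply S.continuous_fPlus.measurable hE, happ hE, happ hE1, happ hE2,
      smul_eq_mul, smul_eq_mul, ← ENNReal.ofReal_mul hpm.le, ← ENNReal.ofReal_mul hpp.le,
      ← ENNReal.ofReal_add (mul_nonneg hpm.le (hnn _)) (mul_nonneg hpp.le (hnn _))]
    set R : Set ℝ := (fun x => 1 - x) ⁻¹' E with hR
    have r1 : (fun x => 1 - x) ⁻¹' (S.fMinus ⁻¹' E) = S.fPlus ⁻¹' R := by
      ext x; simp [hR, hsym.fMinus_one_sub]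
    have r2 : (fun x => 1 - x) ⁻¹' (S.fPlus ⁻¹' E) = S.fMinus ⁻¹' R := by
      ext x; simp [hR, hsym.fPlus_one_sub]
    rw [r1, r2]
    have a1 := h.blockSum_fMinus hm0 hm1 (alternatingProduct βm βp) E
    have a2 := h.blockSum_fMinus hp0 hp1 (alternatingProduct βp βm) R
    have b1 := h.blockSum_fPlus hsym hres hm0 hm1 (alternatingProduct βm βp) E
    have b2 := h.blockSum_fPlus hsym hres hp0 hp1 (alternatingProduct βp βm) R
    have c1 := alternatingProduct_real_codePoint h.pos h.lt_one βm βp hE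
    have c2 := alternatingProduct_real_codePoint h.pos h.lt_one βp βm
      (show MeasurableSet R from (measurable_const.sub measurable_id) hE)
    simp only [hβm, hβp, ENNReal.toReal_ofReal (show 0 ≤ pm / pp * ηp ^ _ by positivity),
      ENNReal.toReal_ofReal (show 0 ≤ pp / pm * ηm ^ _ by positivity), mul_assoc,
      ← Finset.mul_sum] at c1 c2
    simp only [hR, mem_preimage, sub_sub_cancel] at b2 c2
    have a1' := eq_sub_of_add_eq (eq_div_of_mul_eq hm0.ne' ((mul_comm _ _).trans a1))
    have a2' := eq_sub_of_add_eq (eq_div_of_mul_eq hp0.ne' ((mul_comm _ _).trans a2))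
    simp only [hR, mem_preimage] at a2'
    have km : ηm ^ k = (ηm - pm) / (pp * ηm) := by
      rw [eq_div_iff (by positivity)]; linear_combination hηm
    have kp : ηp ^ k = (ηp - pp) / (pm * ηp) := by
      rw [eq_div_iff (by positivity)]; linear_combination hηp
    rw [a1', a2', b1, b2, c1, c2, km, kp]
    congr 1
    field_simp
    ring
  · rw [happ ((measurableSet_singleton _).insert _), hzero, hzero]
    · simp
    · intro n s hs
      have := hmem n s
      simp only [mem_preimage, mem_insert_iff, mem_singleton_iff] at hs
      rcases hs with hs | hs <;> linarith [this.1, this.2]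
    · intro n s hs
      have := hmem n s
      simp only [mem_insert_iff, mem_singleton_iff] at hs
      rcases hs with hs | hs <;> linarith [this.1, this.2]

end Stationary

/-! ### The roots `η₋`, `η₊` and the probability vectors -/

section Roots

variable {p q : ℝ} {k : ℕ}

/-- Apart from `t = 1`, the equation `p t ^ (k + 1) - t + q = 0` is a geometric sum condition. -/
lemma root_iff_geom_sum (hpq : p + q = 1) {t : ℝ} (ht : t ≠ 1) :
    p * t ^ (k + 1) - t + q = 0 ↔ p * ∑ i ∈ Finset.range (k + 1), t ^ i = 1 := by
  have hg := mul_neg_geom_sum t (k + 1)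
  have h1 : 1 - t ≠ 0 := sub_ne_zero.2 ht.symm
  have e : p * t ^ (k + 1) - t + q
      = (1 - t) * (1 - p * ∑ i ∈ Finset.range (k + 1), t ^ i) := by
    linear_combination p * hg + hpq
  rw [e, mul_eq_zero_iff_left h1, sub_eq_zero, eq_comm]

lemma geom_sum_lt_geom_sum (hk : 1 ≤ k) {s t : ℝ} (hs : 0 ≤ s) (hst : s < t) :
    ∑ i ∈ Finset.range (k + 1), s ^ i < ∑ i ∈ Finset.range (k + 1), t ^ i :=
  Finset.sum_lt_sum (fun i _ => pow_le_pow_left₀ hs hst.le i)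
    ⟨1, Finset.mem_range.2 (by omega), by simpa using hst⟩

lemma exists_root (hp : 0 < p) (hq : 0 < q) (hpq : p + q = 1) (hk : 1 ≤ k) (hpk : q < k * p) :
    ∃ η ∈ Ioo (0 : ℝ) 1, p * η ^ (k + 1) - η + q = 0 ∧
      ∀ t ∈ Ioo (0 : ℝ) 1, p * t ^ (k + 1) - t + q = 0 → t = η := by
  obtain ⟨η, hη, hroot⟩ : ∃ η ∈ Ioo (0 : ℝ) 1,
      p * ∑ i ∈ Finset.range (k + 1), η ^ i = 1 := by
    have hc : ContinuousOn (fun t : ℝ => p * ∑ i ∈ Finset.range (k + 1), t ^ i) (Icc 0 1) := by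
      fun_prop
    refine intermediate_value_Ioo zero_le_one hc ⟨?_, ?_⟩
    · simp [Finset.sum_range_succ']
      linarith
    · simp
      nlinarith
  refine ⟨η, hη, (root_iff_geom_sum hpq hη.2.ne).2 hroot, fun t ht hrt => ?_⟩
  have ht' := (root_iff_geom_sum hpq ht.2.ne).1 hrt
  have e := mul_left_cancel₀ hp.ne' (ht'.trans hroot.symm)
  rcases lt_trichotomy t η with hlt | heq | hlt
  · exact absurd e (geom_sum_lt_geom_sum hk ht.1.le hlt).ne
  · exact heq
  · exact absurd e (geom_sum_lt_geom_sum hk hη.1.le hlt).ne'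

lemma sum_pow_succ_eq_one (hq : 0 < q) (hpq : p + q = 1) {η : ℝ} (hη : η ≠ 1)
    (hroot : p * η ^ (k + 1) - η + q = 0) :
    ∑ i : Fin k, p / q * η ^ ((i : ℕ) + 1) = 1 := by
  have h := (root_iff_geom_sum hpq hη).1 hroot
  rw [Finset.sum_range_succ', mul_add, pow_zero, mul_one, Finset.sum_range] at h
  rw [← Finset.mul_sum, div_mul_eq_mul_div, div_eq_one_iff_eq hq.ne']
  linarith

lemma exists_pmf (hp : 0 < p) (hq : 0 < q) (hpq : p + q = 1) {η : ℝ} (hη : η ∈ Ioo (0 : ℝ) 1)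
    (hroot : p * η ^ (k + 1) - η + q = 0) :
    ∃ β : PMF (Fin k), ∀ i : Fin k, β i = ENNReal.ofReal (p / q * η ^ ((i : ℕ) + 1)) := by
  refine ⟨PMF.ofFintype (fun i => ENNReal.ofReal (p / q * η ^ ((i : ℕ) + 1))) ?_, fun i => rfl⟩
  have := hη.1
  rw [← ENNReal.ofReal_sum_of_nonneg fun i _ => by positivity,
    sum_pow_succ_eq_one hq hpq hη.2.ne hroot, ENNReal.ofReal_one]

lemma sum_Icc_one_eq_sum_fin (f : ℕ → ℝ) :
    ∑ r ∈ Finset.Icc 1 k, f r = ∑ i : Fin k, f ((i : ℕ) + 1) := by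
  have e : Finset.Icc 1 k = Finset.Ico 1 (k + 1) := by ext; simp
  rw [e, Finset.sum_Ico_eq_sum_range, Nat.add_sub_cancel, Finset.sum_range]
  exact Finset.sum_congr rfl fun i _ => by rw [add_comm]

/-- In the drift the contributions of the constants `log (p₋ / p₊)` and `log (p₊ / p₋)` cancel. -/
lemma dimDrift_eq {pm pp ηm ηp ρ t : ℝ} (hpm : 0 < pm) (hpp : 0 < pp) (hsum : pm + pp = 1)
    (hm : ηm ∈ Ioo (0 : ℝ) 1) (hp : ηp ∈ Ioo (0 : ℝ) 1)
    (hηm : pp * ηm ^ (k + 1) - ηm + pm = 0) (hηp : pm * ηp ^ (k + 1) - ηp + pp = 0)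
    {βm βp : PMF (Fin k)}
    (hβm : ∀ i : Fin k, βm i = ENNReal.ofReal (pm / pp * ηp ^ ((i : ℕ) + 1)))
    (hβp : ∀ i : Fin k, βp i = ENNReal.ofReal (pp / pm * ηm ^ ((i : ℕ) + 1))) :
    dimDrift ρ βm βp t =
      ∑ r ∈ Finset.Icc 1 k, (r : ℝ) *
          (pp / pm * ηm ^ r * Real.log ηm + pm / pp * ηp ^ r * Real.log ηp) -
        t * ((∑ r ∈ Finset.Icc 1 k, (r : ℝ) * (pp / pm * ηm ^ r + pm / pp * ηp ^ r)) *
          Real.log ρ) := by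
  have hm0 := hm.1
  have hp0 := hp.1
  have s1 := sum_pow_succ_eq_one hpp hsum hp.2.ne hηp
  have s2 := sum_pow_succ_eq_one hpm (by linarith) hm.2.ne hηm
  have l1 : ∀ i : Fin k, Real.log (pm / pp * ηp ^ ((i : ℕ) + 1))
      = Real.log (pm / pp) + ((i : ℕ) + 1) * Real.log ηp := fun i => by
    rw [Real.log_mul (by positivity) (by positivity), Real.log_pow]; push_cast; ring
  have l2 : ∀ i : Fin k, Real.log (pp / pm * ηm ^ ((i : ℕ) + 1))
      = -Real.log (pm / pp) + ((i : ℕ) + 1) * Real.log ηm := fun i => by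
    rw [Real.log_mul (by positivity) (by positivity), Real.log_pow, ← Real.log_inv, inv_div]
    push_cast; ring
  have t1 : ∀ i : Fin k, (βm i).toReal = pm / pp * ηp ^ ((i : ℕ) + 1) := fun i => by
    rw [hβm, ENNReal.toReal_ofReal (by positivity)]
  have t2 : ∀ i : Fin k, (βp i).toReal = pp / pm * ηm ^ ((i : ℕ) + 1) := fun i => by
    rw [hβp, ENNReal.toReal_ofReal (by positivity)]
  have hc : ∑ i : Fin k, (pm / pp * ηp ^ ((i : ℕ) + 1)) * Real.log (pm / pp)
      + ∑ i : Fin k, (pp / pm * ηm ^ ((i : ℕ) + 1)) * -Real.log (pm / pp) = 0 := by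
    rw [← Finset.sum_mul, ← Finset.sum_mul, s1, s2]; ring
  rw [dimDrift, sum_Icc_one_eq_sum_fin, sum_Icc_one_eq_sum_fin]
  simp only [t1, t2, l1, l2]
  rw [← sub_eq_zero, ← hc, ← Finset.sum_add_distrib, ← Finset.sum_add_distrib, Finset.sum_mul,
    Finset.mul_sum, ← Finset.sum_sub_distrib, ← Finset.sum_sub_distrib]
  refine Finset.sum_congr rfl fun i _ => ?_
  push_cast
  ring

end Roots

/-! ### Dimension of the stationary measure -/

section MeasureDim

variable {ρ u : ℝ} {k : ℕ}

lemma measureDimH_le {μ : Measure ℝ} {A : Set ℝ} (hA : MeasurableSet A) (h : μ Aᶜ = 0) :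
    measureDimH μ ≤ dimH A :=
  iInf_le_of_le A (iInf_le_of_le hA (iInf_le _ h))

/-- The union of the sets `ρ ^ n D₁` and `1 - ρ ^ n D₂`. -/
def spread (ρ : ℝ) (D₁ D₂ : Set ℝ) : Set ℝ :=
  (⋃ n : ℕ, (fun x => ρ ^ n * x) '' D₁) ∪ ⋃ n : ℕ, (fun x => 1 - ρ ^ n * x) '' D₂

lemma dimH_spread_le {D₁ D₂ : Set ℝ} {t : ℝ≥0∞} (h₁ : dimH D₁ ≤ t) (h₂ : dimH D₂ ≤ t) :
    dimH (spread ρ D₁ D₂) ≤ t := by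
  rw [spread, dimH_union, dimH_iUnion, dimH_iUnion]
  refine max_le (iSup_le fun n => ?_) (iSup_le fun n => ?_)
  · exact (ContDiffOn.dimH_image_le (s := univ) (by fun_prop) convex_univ
      (subset_univ _)).trans h₁
  · exact (ContDiffOn.dimH_image_le (s := univ) (by fun_prop) convex_univ
      (subset_univ _)).trans h₂

lemma measurableSet_spread (h0 : 0 < ρ) {D₁ D₂ : Set ℝ} (h₁ : MeasurableSet D₁)
    (h₂ : MeasurableSet D₂) : MeasurableSet (spread ρ D₁ D₂) := by
  refine (MeasurableSet.iUnion fun n => ?_).union (MeasurableSet.iUnion fun n => ?_)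
  · exact h₁.image_of_continuousOn_injOn (by fun_prop)
      (mul_right_injective₀ (pow_pos h0 n).ne').injOn
  · refine h₂.image_of_continuousOn_injOn (by fun_prop) fun x _ y _ hxy => ?_
    exact mul_right_injective₀ (pow_pos h0 n).ne' (sub_right_injective hxy)

lemma blockSum_eq_zero {η : ℝ} {ν : Measure (SymSeq k)} {E : Set ℝ}
    (h : ∀ n : ℕ, ν {s | ρ ^ n * codePoint ρ s ∈ E} = 0) : blockSum ρ η ν E = 0 := by
  simp [blockSum, measureReal_def, h]

variable {cm cp ηm ηp : ℝ} {βm βp : PMF (Fin k)}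

lemma map_fullCode_compl_spread (h0 : 0 < ρ) (h1 : ρ < 1) (hcm : 0 < cm) (hcp : 0 < cp)
    (hm : ηm ∈ Ioo (0 : ℝ) 1) (hp : ηp ∈ Ioo (0 : ℝ) 1) {D₁ D₂ : Set ℝ}
    (hD₁ : MeasurableSet D₁) (hD₂ : MeasurableSet D₂)
    (h₁ : alternatingProduct βm βp (codePoint ρ ⁻¹' D₁ᶜ) = 0)
    (h₂ : alternatingProduct βp βm (codePoint ρ ⁻¹' D₂ᶜ) = 0) :
    (symbolicMeasure cm cp ηm ηp βm βp).map (fullCode ρ (codePoint ρ)) (spread ρ D₁ D₂)ᶜ = 0 := by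
  rw [map_fullCode_apply h0 h1 hcm.le hcp.le hm.1 hm.2 hp.1 hp.2 _ _
    (measurableSet_spread h0 hD₁ hD₂).compl, blockSum_eq_zero, blockSum_eq_zero]
  · simp
  · refine fun n => measure_mono_null (t := codePoint ρ ⁻¹' D₂ᶜ) (fun s hs hsD => hs ?_) h₂
    exact Or.inr (mem_iUnion.2 ⟨n, _, hsD, rfl⟩)
  · refine fun n => measure_mono_null (t := codePoint ρ ⁻¹' D₁ᶜ) (fun s hs hsD => hs ?_) h₁
    exact Or.inl (mem_iUnion.2 ⟨n, _, hsD, rfl⟩)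

/-- The dimension is the zero of the affine function `dimDrift`. -/
lemma IsCodingParam.measureDimH_eq (h : IsCodingParam ρ u k) (hcm : 0 < cm) (hcp : 0 < cp)
    (hm : ηm ∈ Ioo (0 : ℝ) 1) (hp : ηp ∈ Ioo (0 : ℝ) 1)
    (hβm : ∀ a, βm a ≠ 0) (hβp : ∀ a, βp a ≠ 0) {N D : ℝ} (hN : N < 0) (hD : D < 0)
    (hdrift : ∀ t, dimDrift ρ βm βp t = N - t * D) :
    measureDimH ((symbolicMeasure cm cp ηm ηp βm βp).map (fullCode ρ (codePoint ρ))) =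
      ENNReal.ofReal (N / D) := by
  have hd : 0 < N / D := div_pos_of_neg_of_neg hN hD
  have hdrift' : ∀ t, dimDrift ρ βp βm t = N - t * D := fun t => by
    rw [← hdrift, dimDrift, dimDrift, add_comm]
  refine le_antisymm ?_ (le_iInf fun E => le_iInf fun hE => le_iInf fun hfull => ?_)
  · refine ge_of_tendsto (x := 𝓝[>] (N / D))
      (ENNReal.continuous_ofReal.continuousWithinAt (x := N / D)).tendsto ?_
    filter_upwards [self_mem_nhdsWithin] with t ht
    have htpos : 0 < N - t * D := by
      have := (div_lt_iff_of_neg hD).1 ht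
      linarith
    have ht0 : 0 < t := hd.trans ht
    obtain ⟨D₁, m₁, d₁, z₁⟩ := h.exists_dimH_le hβm hβp ht0 (by rwa [hdrift])
    obtain ⟨D₂, m₂, d₂, z₂⟩ := h.exists_dimH_le hβp hβm ht0 (by rwa [hdrift'])
    exact (measureDimH_le (measurableSet_spread h.pos m₁ m₂)
      (map_fullCode_compl_spread h.pos h.lt_one hcm hcp hm hp m₁ m₂ z₁ z₂)).trans
      (dimH_spread_le d₁ d₂)
  · refine le_of_tendsto (x := 𝓝[<] (N / D))
      (ENNReal.continuous_ofReal.continuousWithinAt (x := N / D)).tendsto ?_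
    filter_upwards [self_mem_nhdsWithin, mem_nhdsWithin_of_mem_nhds (Ioi_mem_nhds hd)]
      with t ht ht0
    have htneg : N - t * D < 0 := by
      have := (lt_div_iff_of_neg hD).1 ht
      linarith
    refine h.le_dimH hβm hβp ht0 (by rwa [hdrift]) hE ?_
    rw [map_fullCode_apply h.pos h.lt_one hcm.le hcp.le hm.1 hm.2 hp.1 hp.2 _ _ hE.compl,
      ENNReal.ofReal_eq_zero] at hfull
    have b1 := blockSum_nonneg (ρ := ρ) hm.1 (alternatingProduct βm βp) Eᶜ
    have b2 := mul_nonneg hcp.le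
      (blockSum_nonneg (ρ := ρ) hp.1 (alternatingProduct βp βm) ((fun x => 1 - x) ⁻¹' Eᶜ))
    have b3 : blockSum ρ ηm (alternatingProduct βm βp) Eᶜ ≤ 0 := by
      by_contra! hc
      have := mul_pos hcm hc
      linarith
    have b4 := (summable_blockSum hm.1 hm.2 (alternatingProduct βm βp)
      fun n => {s | ρ ^ n * codePoint ρ s ∈ Eᶜ}).le_tsum 0 fun n _ => by
        have := hm.1; positivity
    have b5 : (alternatingProduct βm βp).real {s | ρ ^ 0 * codePoint ρ s ∈ Eᶜ} ≤ 0 := by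
      by_contra! hc
      have := mul_pos (pow_pos hm.1 (0 + 1)) hc
      exact absurd (b4.trans b3) (not_le.2 this)
    have b6 := le_antisymm b5 measureReal_nonneg
    rw [measureReal_eq_zero_iff] at b6
    simp only [pow_zero, one_mul] at b6
    exact b6

/-- The support lies in the closure of the spread of the attractor `codePoint ρ '' univ`, which
adds only the two endpoints. -/
lemma dimH_support_le (h0 : 0 < ρ) (h1 : ρ < 1) (hcm : 0 < cm) (hcp : 0 < cp)
    (hm : ηm ∈ Ioo (0 : ℝ) 1) (hp : ηp ∈ Ioo (0 : ℝ) 1) :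
    dimH ((symbolicMeasure cm cp ηm ηp βm βp).map (fullCode ρ (codePoint ρ))).support ≤
      dimH (range (codePoint ρ : SymSeq k → ℝ)) := by
  set K := range (codePoint ρ : SymSeq k → ℝ)
  have hK : IsCompact K := isCompact_range (continuous_codePoint h0 h1)
  let T : Set ℝ := insert 0 (range fun n : ℕ => ρ ^ n)
  have hT : IsCompact T :=
    (tendsto_pow_atTop_nhds_zero_of_lt_one h0.le h1).isCompact_insert_range
  have hL : IsCompact ((fun q : ℝ × ℝ => q.1 * q.2) '' (T ×ˢ K)) :=
    (hT.prod hK).image (by fun_prop)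
  have hR : IsCompact ((fun q : ℝ × ℝ => 1 - q.1 * q.2) '' (T ×ˢ K)) :=
    (hT.prod hK).image (by fun_prop)
  have hnull := map_fullCode_compl_spread (βm := βm) (βp := βp) h0 h1 hcm hcp hm hp
    hK.measurableSet hK.measurableSet
    (by rw [preimage_compl, preimage_range, compl_univ, measure_empty])
    (by rw [preimage_compl, preimage_range, compl_univ, measure_empty])
  have hsub := Measure.support_subset_of_isClosed (hL.union hR).isClosed
    (mem_ae_iff.2 (measure_mono_null (compl_subset_compl.2 (fun x hx => ?_)) hnull))
  · refine (dimH_mono (Subset.trans (c := ({0, 1} : Set ℝ) ∪ spread ρ K K) hsub ?_)).trans ?_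
    · rintro _ (⟨⟨a, b⟩, ⟨ha, hb⟩, rfl⟩ | ⟨⟨a, b⟩, ⟨ha, hb⟩, rfl⟩)
      · rcases ha with ha | ⟨n, hn⟩
        · left; left; simp only at ha ⊢; rw [ha, zero_mul]
        · right; left
          exact mem_iUnion.2 ⟨n, b, hb, by simp only at hn ⊢; rw [hn]⟩
      · rcases ha with ha | ⟨n, hn⟩
        · left; right; simp only at ha ⊢; rw [ha, zero_mul, sub_zero]; rfl
        · right; right
          exact mem_iUnion.2 ⟨n, b, hb, by simp only at hn ⊢; rw [hn]⟩
    · rw [dimH_union, dimH_countable (Set.to_countable _)]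
      exact max_le zero_le (dimH_spread_le le_rfl le_rfl)
  · rcases hx with hx | hx
    · obtain ⟨n, y, hy, rfl⟩ := mem_iUnion.1 hx
      exact Or.inl ⟨(ρ ^ n, y), ⟨Or.inr ⟨n, rfl⟩, hy⟩, rfl⟩
    · obtain ⟨n, y, hy, rfl⟩ := mem_iUnion.1 hx
      exact Or.inr ⟨(ρ ^ n, y), ⟨Or.inr ⟨n, rfl⟩, hy⟩, rfl⟩

/-- If the symbol `r` has probability `η ^ r`, then every cylinder has mass equal to the power
`log η / log ρ` of its diameter. -/
lemma IsCodingParam.dimH_range_codePoint_le (h : IsCodingParam ρ u k) {η : ℝ}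
    (hη : η ∈ Ioo (0 : ℝ) 1) {β : PMF (Fin k)}
    (hβ : ∀ i : Fin k, β i = ENNReal.ofReal (η ^ ((i : ℕ) + 1))) :
    dimH (range (codePoint ρ : SymSeq k → ℝ)) ≤ ENNReal.ofReal (Real.log η / Real.log ρ) := by
  have hlρ : Real.log ρ < 0 := Real.log_neg h.pos h.lt_one
  have ht : 0 < Real.log η / Real.log ρ :=
    div_pos_of_neg_of_neg (Real.log_neg hη.1 hη.2) hlρ
  rw [← image_univ]
  refine h.dimH_image_le (β := β) (β' := β) (N := 0) ht fun s _ n _ => le_of_eq ?_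
  have hβ0 : ∀ a, β a ≠ 0 := fun a => by
    rw [hβ, ne_eq, ENNReal.ofReal_eq_zero, not_le]; exact pow_pos hη.1 _
  rw [cylinderMass_eq_exp hβ0 hβ0, ofReal_pow_rpow_eq_exp h.pos ht.le]
  congr 2
  refine Finset.sum_congr rfl fun i _ => ?_
  rw [ite_self, hβ, ENNReal.toReal_ofReal (pow_nonneg hη.1.le _), Real.log_pow]
  push_cast
  rw [mul_right_comm, div_mul_cancel₀ _ hlρ.ne, mul_comm]

end MeasureDim

theorem theorem2p5 (S : AMSystem) (pm pp : ℝ) (hpm : 0 < pm) (hpp : 0 < pp) (hsum : pm + pp = 1)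
    (hsym : S.IsSymmetric) (hdisj : S.IsDisjointType)
    (hlyap0 : 0 < S.lyapunov pm pp 0) (hlyap1 : 0 < S.lyapunov pm pp 1)
    (k : ℕ) (hk : 2 ≤ k) (hres : S.HasResonanceAtZero k 1 ∨ S.HasResonanceAtOne k 1)
    (ρ : ℝ) (hρ : ρ = S.dMinus 0) :
    ∃ (μ : Measure ℝ) (ηm ηp : ℝ),
      -- `μ` is the unique stationary measure without atoms at the endpoints
      S.IsStationary pm pp μ ∧ (∀ ν : Measure ℝ, S.IsStationary pm pp ν → ν = μ) ∧
      -- `η₋`, `η₊` are the unique roots in `(0, 1)` of their equations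
      (ηm ∈ Ioo (0 : ℝ) 1 ∧ pp * ηm ^ (k + 1) - ηm + pm = 0 ∧
        ∀ t ∈ Ioo (0 : ℝ) 1, pp * t ^ (k + 1) - t + pm = 0 → t = ηm) ∧
      (ηp ∈ Ioo (0 : ℝ) 1 ∧ pm * ηp ^ (k + 1) - ηp + pp = 0 ∧
        ∀ t ∈ Ioo (0 : ℝ) 1, pm * t ^ (k + 1) - t + pp = 0 → t = ηp) ∧
      -- the dimension formula
      measureDimH μ = ENNReal.ofReal
        ((∑ r ∈ Finset.Icc 1 k, (r : ℝ) *
            (pp / pm * ηm ^ r * Real.log ηm + pm / pp * ηp ^ r * Real.log ηp)) /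
          ((∑ r ∈ Finset.Icc 1 k, (r : ℝ) * (pp / pm * ηm ^ r + pm / pp * ηp ^ r)) *
            Real.log ρ)) ∧
      -- `μ` is the image under the coding map of an explicit symbolic product measure
      (∃ (code : SymSeq k → ℝ) (βm βp : PMF (Fin k)),
        (∀ s : SymSeq k, ∀ x ∈ S.baseInterval,
          Tendsto (fun n => simComp ρ s n x) atTop (𝓝 (code s))) ∧
        (∀ i : Fin k, βm i = ENNReal.ofReal (pm / pp * ηp ^ ((i : ℕ) + 1))) ∧
        (∀ i : Fin k, βp i = ENNReal.ofReal (pp / pm * ηm ^ ((i : ℕ) + 1))) ∧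
        μ = (symbolicMeasure
          (pp / (pp * (ηm / (1 - ηm)) + pm * (ηp / (1 - ηp))))
          (pm / (pp * (ηm / (1 - ηm)) + pm * (ηp / (1 - ηp))))
          ηm ηp βm βp).map (fullCode ρ code)) ∧
      -- the case of equal probabilities
      (pm = 1 / 2 → pp = 1 / 2 → ∃ η : ℝ,
        (η ∈ Ioo (1 / 2 : ℝ) 1 ∧ η ^ (k + 1) - 2 * η + 1 = 0 ∧
          ∀ t ∈ Ioo (1 / 2 : ℝ) 1, t ^ (k + 1) - 2 * t + 1 = 0 → t = η) ∧
        measureDimH μ = ENNReal.ofReal (Real.log η / Real.log ρ) ∧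
        dimH μ.support = ENNReal.ofReal (Real.log η / Real.log ρ) ∧
        Real.log η / Real.log ρ < 1) := by
  have hk1 : 1 ≤ k := by omega
  rw [S.dMinus_zero] at hρ
  subst hρ
  have h0 := S.am_pos
  have h1 := S.am_lt_one
  have hlog : Real.log S.am < 0 := Real.log_neg h0 h1
  have hres' : S.am ^ k * S.bm = 1 := by
    rcases hres with hr | hr
    · rw [AMSystem.HasResonanceAtZero, S.dMinus_zero, S.dPlus_zero, hsym.bp_eq_bm, pow_one] at hr
      exact hr
    · rw [AMSystem.HasResonanceAtOne, S.dMinus_one, S.dPlus_one, hsym.ap_eq_am, pow_one] at hr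
      linarith
  have hlogb : Real.log S.bm = -(k * Real.log S.am) := by
    rw [eq_inv_of_mul_eq_one_right hres', Real.log_inv, Real.log_pow]
  have hpk : pm < k * pp := by
    rw [AMSystem.lyapunov, S.dMinus_zero, S.dPlus_zero, hsym.bp_eq_bm, hlogb] at hlyap0
    by_contra! hc
    have := mul_le_mul_of_nonpos_right hc hlog.le
    linarith
  have hpk' : pp < k * pm := by
    rw [AMSystem.lyapunov, S.dMinus_one, S.dPlus_one, hsym.ap_eq_am, hlogb] at hlyap1
    by_contra! hc
    have := mul_le_mul_of_nonpos_right hc hlog.le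
    linarith
  have h := hsym.isCodingParam hdisj hk1 hres'
  obtain ⟨ηm, hm, hrm, hum⟩ := exists_root hpp hpm (by linarith) hk1 hpk
  obtain ⟨ηp, hp, hrp, hup⟩ := exists_root hpm hpp hsum hk1 hpk'
  obtain ⟨βm, hβm⟩ := exists_pmf hpm hpp hsum hp hrp
  obtain ⟨βp, hβp⟩ := exists_pmf hpp hpm (by linarith) hm hrm
  have hm0 := hm.1
  have hp0 := hp.1
  have hm1 : 0 < 1 - ηm := sub_pos.2 hm.2
  have hp1 : 0 < 1 - ηp := sub_pos.2 hp.2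
  have hcm : 0 < pp / (pp * (ηm / (1 - ηm)) + pm * (ηp / (1 - ηp))) := by positivity
  have hcp : 0 < pm / (pp * (ηm / (1 - ηm)) + pm * (ηp / (1 - ηp))) := by positivity
  have hβm0 : ∀ a, βm a ≠ 0 := fun a => by
    rw [hβm, ne_eq, ENNReal.ofReal_eq_zero, not_le]; positivity
  have hβp0 : ∀ a, βp a ≠ 0 := fun a => by
    rw [hβp, ne_eq, ENNReal.ofReal_eq_zero, not_le]; positivity
  have hne : (Finset.Icc 1 k).Nonempty := ⟨1, Finset.mem_Icc.2 ⟨le_rfl, hk1⟩⟩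
  have hN : ∑ r ∈ Finset.Icc 1 k, (r : ℝ) *
      (pp / pm * ηm ^ r * Real.log ηm + pm / pp * ηp ^ r * Real.log ηp) < 0 := by
    refine Finset.sum_neg (fun r hr => ?_) hne
    have hr0 : (0 : ℝ) < r := Nat.cast_pos.2 (Finset.mem_Icc.1 hr).1
    refine mul_neg_of_pos_of_neg hr0 (add_neg ?_ ?_)
    · exact mul_neg_of_pos_of_neg (by positivity) (Real.log_neg hm.1 hm.2)
    · exact mul_neg_of_pos_of_neg (by positivity) (Real.log_neg hp.1 hp.2)
  have hDpos : 0 < ∑ r ∈ Finset.Icc 1 k, (r : ℝ) * (pp / pm * ηm ^ r + pm / pp * ηp ^ r) := by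
    refine Finset.sum_pos (fun r hr => ?_) hne
    have hr0 : (0 : ℝ) < r := Nat.cast_pos.2 (Finset.mem_Icc.1 hr).1
    positivity
  have hstat := isStationary_map_fullCode hpm hpp hsum hsym h hres' hm.1 hm.2 hp.1 hp.2 hrm hrp
    hβm hβp
  have hdim := h.measureDimH_eq hcm hcp hm hp hβm0 hβp0 hN (mul_neg_of_pos_of_neg hDpos hlog)
    fun t => dimDrift_eq hpm hpp hsum hm hp hrm hrp hβm hβp
  refine ⟨_, ηm, ηp, hstat, fun ν hν => hν.unique hstat hpm hpp hsum, ⟨hm, hrm, hum⟩,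
    ⟨hp, hrp, hup⟩, hdim, ⟨codePoint S.am, βm, βp, fun s x _ => tendsto_simComp h0 h1 s x, hβm,
    hβp, rfl⟩, ?_⟩
  rintro rfl rfl
  have heq : ηp = ηm := hum ηp hp hrp
  subst heq
  have hval : (∑ r ∈ Finset.Icc 1 k, (r : ℝ) * ((1 / 2 : ℝ) / (1 / 2) * ηp ^ r * Real.log ηp +
      (1 / 2 : ℝ) / (1 / 2) * ηp ^ r * Real.log ηp)) /
        ((∑ r ∈ Finset.Icc 1 k, (r : ℝ) * ((1 / 2 : ℝ) / (1 / 2) * ηp ^ r +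
          (1 / 2 : ℝ) / (1 / 2) * ηp ^ r)) * Real.log S.am) = Real.log ηp / Real.log S.am := by
    rw [← mul_div_mul_left (Real.log ηp) _ hDpos.ne', Finset.sum_mul (s := Finset.Icc 1 k)
      (a := Real.log ηp)]
    congr 1
    exact Finset.sum_congr rfl fun r _ => by ring
  rw [hval] at hdim
  refine ⟨ηp, ⟨⟨?_, hp.2⟩, by linarith, fun t ht hrt => hum t ⟨by linarith [ht.1], ht.2⟩
    (by linarith)⟩, hdim, le_antisymm ?_ ?_, ?_⟩
  · have := pow_pos hp.1 (k + 1)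
    linarith
  · refine (dimH_support_le h0 h1 hcm hcp hm hp).trans
      (h.dimH_range_codePoint_le hp (β := βm) fun i => ?_)
    rw [hβm, div_self (by norm_num), one_mul]
  · rw [← hdim]
    exact measureDimH_le Measure.isClosed_support.measurableSet Measure.measure_compl_support
  · -- disjointness says `ρ ^ (k + 1) - 2 ρ + 1 > 0`, which places `ρ` to the left of `η`
    rw [div_lt_one_of_neg hlog]
    refine Real.log_lt_log h0 ?_
    have hlt : ∑ i ∈ Finset.range (k + 1), S.am ^ i < 2 := by
      have hg := mul_neg_geom_sum S.am (k + 1)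
      have hfix := h.fixed
      have hhalf := h.lt_half
      have hpw : S.am ^ (k + 1) < 1 := pow_lt_one₀ h0.le h1 (by omega)
      have hpos : 0 < 1 - 2 * S.am + S.am ^ (k + 1) := by
        rw [pow_succ] at hpw ⊢
        nlinarith
      by_contra! hc
      have := mul_le_mul_of_nonneg_left hc (sub_pos.2 h1).le
      linarith
    have hη2 := (root_iff_geom_sum (k := k) (by norm_num : (1 / 2 : ℝ) + 1 / 2 = 1) hp.2.ne).1 hrp
    by_contra! hc
    rcases hc.eq_or_lt with he | hl
    · rw [← he] at hlt; linarith
    · have := geom_sum_lt_geom_sum hk1 hp.1.le hl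
      linarith
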